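/- Fix $\omega>0$, $\alpha\in\mathbb R$ with $\beta:=-\tfrac{16}{3}\alpha\omega<1$, and real $a,b,d_2$. For real $\epsilon,d_1,c$ put $\Delta=1+\epsilon^2a^2$ and consider, for $r>0$, the steady-state system \[ \begin{aligned} r'&=rs,\\ \Delta s'&=-\Delta s^2+\Delta\phi^2-c(\epsilon as-\phi)-(-\omega+\epsilon^2ab)-(1+\epsilon^2ad_1)r^2-(\alpha+\epsilon^2ad_2)r^4,\\ \Delta\phi'&=-2\Delta s\phi-c(s+\epsilon a\phi)-\epsilon\big[(b+a\omega)+(d_1-a)r^2+(d_2-a\alpha)r^4\big]. \end{aligned} \] For $\epsilon=c=0$ it has the solution $(R_0,S_0,0)$ with $R_0(z)^2=\dfrac{4\omega}{1+\sqrt{1-\beta}\,\cosh(2\sqrt\omega\,z)}$, $R_0>0$, $S_0=R_0'/R_0$. A solitary wave is a solution $(R,S,\Phi)$ on $\mathbb R$ with $c=0$, $R>0$, which tends to a point $(0,s_0,\phi_0)$ with $s_0>0$ as $z\to-\infty$ and to one with $s_0<0$ as $z\to+\infty$. Given such a wave, let $W^u(z,c)$ be any parametrization of the unstable manifolds containing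 it: $W^u(\cdot,0)=(R,S,\Phi)$; for every $L$ there is $\delta>0$ such that $W^u$ is $C^1$ on $(-\infty,L)\times(-\delta,\delta)$ and, for $|c|<\delta$, $W^u(\cdot,c)$ solves the system with speed $c$ and $r>0$ on $(-\infty,L)$ and tends to a point $(0,s_0,\phi_0)$ with $s_0>0$ as $z\to-\infty$; and $\partial_cW^u(\cdot,0)$ is bounded on $(-\infty,0]$. Let $W^s$ be defined analogously for the stable manifolds, on $(L,\infty)$, with $s_0<0$ as $z\to+\infty$ and $\partial_cW^s(\cdot,0)$ bounded on $[0,\infty)$. At $c=0$ set $\xi_1=\partial_zW^u$, $\xi_2^-=\partial_cW^u$, $\xi_2^+=\partial_cW^s$, $\phi_c^\pm=\delta\phi(\xi_2^\pm)$, and \[ P_{r\phi}^\pm=(\delta r\wedge\delta\phi)(\xi_1,\xi_2^\pm),\qquad P_{s\phi}^\pm=(\delta s\wedge\delta\phi)(\xi_1,\xi_2^\pm), \] where $\delta r,\delta s,\delta\phi$ are the coordinate forms and $(x\wedge y)(\xi,\eta)=x(\xi)y(\eta)-y(\xi)x(\eta)$. 1. If $\epsilon=0$ and the wave is $(R_0,S_0,0)$,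 then for all $z\in\mathbb R$ \[ \phi_c^\pm(z)=-\tfrac12,\qquad P_{r\phi}^\pm(z)=-\tfrac12R_0'(z),\qquad P_{s\phi}^\pm(z)=-\tfrac12S_0'(z). \] 2. For all small $\epsilon>0$ let $d_1=d_1(\epsilon)$ and let $(R_\epsilon,S_\epsilon,\Phi_\epsilon)$ be a solitary wave for the coefficients $(\epsilon,a,b,d_1(\epsilon),d_2,\alpha)$ such that $(R_\epsilon,S_\epsilon,\Phi_\epsilon)\to(R_0,S_0,0)$ uniformly on $\mathbb R$ as $\epsilon\to0^+$. Then for every $M>0$ there are $C,\epsilon_0>0$ such that, for all $0<\epsilon<\epsilon_0$, all such $W^u,W^s$ along the wave $(R_\epsilon,S_\epsilon,\Phi_\epsilon)$ and all $|z|\le M$, \[ |P_{r\phi}^+(z)-P_{r\phi}^-(z)|\le C\epsilon,\qquad |P_{s\phi}^+(z)-P_{s\phi}^-(z)|\le C\epsilon. \] -/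

import Mathlib

open Set Filter Topology

noncomputable section

namespace CubicQuintic

/-- Coefficients of the perturbed cubic-quintic equation: the size `ε` of the perturbation, the
dissipative coefficients `a`, `b`, `d₁`, `d₂`, and the quintic coefficient `α`. -/
structure Coeffs where
  ε : ℝ
  a : ℝ
  b : ℝ
  d₁ : ℝ
  d₂ : ℝ
  α : ℝ

/-- Phase points `(r, s, φ)` (the phase `θ` decouples: `θ' = φ`). The same type is used for
tangent vectors `(δr, δs, δφ)`. -/
abbrev State : Type := ℝ × ℝ × ℝ

/-- The coordinate form `δr`. -/
def δr : State →ₗ[ℝ] ℝ := LinearMap.fst ℝ ℝ (ℝ × ℝ)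

/-- The coordinate form `δs`. -/
def δs : State →ₗ[ℝ] ℝ := LinearMap.fst ℝ ℝ ℝ ∘ₗ LinearMap.snd ℝ ℝ (ℝ × ℝ)

/-- The coordinate form `δφ`. -/
def δφ : State →ₗ[ℝ] ℝ := LinearMap.snd ℝ ℝ ℝ ∘ₗ LinearMap.snd ℝ ℝ (ℝ × ℝ)

/-- The value `(x ∧ y)(ξ, η)` of the wedge product of two linear forms. -/
def wedge (x y : State →ₗ[ℝ] ℝ) (ξ η : State) : ℝ := x ξ * y η - y ξ * x η

/-- `Δ = 1 + ε² a²`. -/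
def Coeffs.Δ (p : Coeffs) : ℝ := 1 + p.ε ^ 2 * p.a ^ 2

/-- The right-hand side of the steady-state ODE in the variables `(r, s, φ)`, with wave speed `c`
and frequency `ω`; the last two equations are divided by `Δ > 0`. -/
def Coeffs.field (p : Coeffs) (ω c : ℝ) (u : State) : State :=
  let r := u.1
  let s := u.2.1
  let φ := u.2.2
  (r * s,
   (-p.Δ * s ^ 2 + p.Δ * φ ^ 2 - c * (p.ε * p.a * s - φ) - (-ω + p.ε ^ 2 * p.a * p.b)
      - (1 + p.ε ^ 2 * p.a * p.d₁) * r ^ 2 - (p.α + p.ε ^ 2 * p.a * p.d₂) * r ^ 4) / p.Δ,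
   (-2 * p.Δ * s * φ - c * (s + p.ε * p.a * φ)
      - p.ε * ((p.b + p.a * ω) + (p.d₁ - p.a) * r ^ 2 + (p.d₂ - p.a * p.α) * r ^ 4)) / p.Δ)

/-- `u` solves the steady-state ODE, with `r > 0`, on the open set `I`. -/
def Coeffs.SolvesOn (p : Coeffs) (ω c : ℝ) (u : ℝ → State) (I : Set ℝ) : Prop :=
  ∀ z ∈ I, 0 < (u z).1 ∧ HasDerivAt u (p.field ω c (u z)) z

/-- As `z → -∞`, `u` tends to a rest state with `r = 0` and `s > 0`. -/
def EmanatesFromZero (u : ℝ → State) : Prop :=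
  ∃ s₀ φ₀ : ℝ, 0 < s₀ ∧ Tendsto u atBot (𝓝 (0, s₀, φ₀))

/-- As `z → +∞`, `u` tends to a rest state with `r = 0` and `s < 0`. -/
def DecaysToZero (u : ℝ → State) : Prop :=
  ∃ s₀ φ₀ : ℝ, s₀ < 0 ∧ Tendsto u atTop (𝓝 (0, s₀, φ₀))

/-- A bright solitary wave `(R, S, Φ)` of speed `c = 0` and frequency `ω`. -/
structure Coeffs.IsSolitaryWave (p : Coeffs) (ω : ℝ) (u : ℝ → State) : Prop where
  solves : p.SolvesOn ω 0 u univ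
  emanates : EmanatesFromZero u
  decays : DecaysToZero u

/-- `W z c` is a continuously differentiable parametrisation of the unstable manifolds (one
trajectory for each speed `c` near `0`) of the rest state with `r = 0`, `s > 0`, which at `c = 0`
runs along the wave `u`. For every `L` the trajectories with small `|c|` exist on `(-∞, L)`;
the derivative with respect to `c` at `c = 0` is bounded as `z → -∞`. -/
structure Coeffs.IsUnstableFamily (p : Coeffs) (ω : ℝ) (u : ℝ → State)
    (W : ℝ → ℝ → State) : Prop where
  base : ∀ z, W z 0 = u z
  regular : ∀ L : ℝ, ∃ δ > 0,
    ContDiffOn ℝ 1 (fun q : ℝ × ℝ => W q.1 q.2) (Iio L ×ˢ Ioo (-δ) δ) ∧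
    ∀ c ∈ Ioo (-δ) δ,
      p.SolvesOn ω c (fun z => W z c) (Iio L) ∧ EmanatesFromZero (fun z => W z c)
  bounded : ∃ K : ℝ, ∀ z ≤ 0, ‖deriv (fun c => W z c) 0‖ ≤ K

/-- The analogue at `+∞`: `W z c` is a continuously differentiable parametrisation of the stable
manifolds of the rest state with `r = 0`, `s < 0`, which at `c = 0` runs along the wave `u`. -/
structure Coeffs.IsStableFamily (p : Coeffs) (ω : ℝ) (u : ℝ → State)
    (W : ℝ → ℝ → State) : Prop where
  base : ∀ z, W z 0 = u z
  regular : ∀ L : ℝ, ∃ δ > 0,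
    ContDiffOn ℝ 1 (fun q : ℝ × ℝ => W q.1 q.2) (Ioi L ×ˢ Ioo (-δ) δ) ∧
    ∀ c ∈ Ioo (-δ) δ,
      p.SolvesOn ω c (fun z => W z c) (Ioi L) ∧ DecaysToZero (fun z => W z c)
  bounded : ∃ K : ℝ, ∀ z ≥ 0, ‖deriv (fun c => W z c) 0‖ ≤ K

/-- `ξ₁ = ∂_z W` at `c = 0`. -/
def ξ₁ (W : ℝ → ℝ → State) (z : ℝ) : State := deriv (fun y => W y 0) z

/-- `ξ₂ = ∂_c W` at `c = 0`. -/
def ξ₂ (W : ℝ → ℝ → State) (z : ℝ) : State := deriv (fun c => W z c) 0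

/-- `β = -16 α ω / 3`. -/
def β (α ω : ℝ) : ℝ := -(16 / 3) * α * ω

/-- The unperturbed profile, `R₀² = 4ω / (1 + √(1 - β) cosh (2 √ω z))`. -/
def R₀ (α ω z : ℝ) : ℝ :=
  √(4 * ω / (1 + √(1 - β α ω) * Real.cosh (2 * √ω * z)))

/-- `S₀ = R₀' / R₀`. -/
def S₀ (α ω z : ℝ) : ℝ := deriv (R₀ α ω) z / R₀ α ω z

/-- The unperturbed wave `(R₀, S₀, 0)`. -/
def wave₀ (α ω z : ℝ) : State := (R₀ α ω z, S₀ α ω z, 0)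

end CubicQuintic

end

/-! Since R' = R S, a solution of f' = -2 S f + g satisfies (R² f)' = R² g. As R → 0 at -∞, a
solution bounded there is determined by g, and `damped_le` and `Profile.abs_le_of_damped` bound it
by a multiple of sup |g|. The unknown bound at -∞ does not enter the result.

At ε = 0 the phase component w of the speed derivative solves w' = -2 S w - S. Hence f = w + 1/2 has
g = 0, so w = -1/2. The phase component of ξ₁ vanishes, and each wedge product reduces to -1/2 times
a component of ξ₁. The stable side follows from the symmetry (z, c, r, s, φ) ↦ (-z, -c, r, -s, -φ).

For ε > 0 the same f has g = O(ε), as soon as three things are known uniformly in ε and in the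
chosen families. (i) d₁ is bounded. A wave exists only if its phase equation is solvable with
bounded Φ on the whole line; integrating (R² Φ)' bounds the coefficient of the R² term by the other
terms (`Profile.coeff_le`). Then Φ, Φ' and the coupling `Coeffs.qφ` are O(ε). (ii) The families are
fixed only up to a speed-dependent time shift, so ξ₂ is fixed only up to multiples of ξ₁. These do
not change the wedge product, and are used to make δr vanish at -L. (iii) The normalised ξ₂ is
bounded (`Profile.linear_bound`). On the tail R and Φ are at most τ, so the coupling is absorbed by
the damping; on [-L, L] Grönwall applies.

The difference of two wedge products is x(ξ₁) times a difference of phase components, which is O(ε),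
minus Φ' = O(ε) times a bounded quantity. -/

noncomputable section

namespace CubicQuintic

/-! ### Differentiation with respect to a parameter -/

/-- Exchange of a parameter derivative with the time derivative. -/
theorem hasDerivAt_param_deriv {E : Type*} [NormedAddCommGroup E] [NormedSpace ℝ E]
    {U V : ℝ × ℝ → E} {V' : ℝ × ℝ →L[ℝ] E} {ξ : ℝ → E} {z₀ c₀ : ℝ}
    (hV : HasStrictFDerivAt V V' (z₀, c₀))
    (hU : ∀ᶠ q in 𝓝 (z₀, c₀), HasDerivAt (fun z => U (z, q.2)) (V q) q.1)
    (hξ : ∀ᶠ z in 𝓝 z₀, HasDerivAt (fun c => U (z, c)) (ξ z) c₀) :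
    HasDerivAt ξ (V' (0, 1)) z₀ := by
  have key := hasDerivAt_of_tendstoUniformlyOnFilter (l := 𝓝[≠] c₀) (x := z₀)
    (f := fun c z => (c - c₀)⁻¹ • (U (z, c) - U (z, c₀)))
    (f' := fun c z => (c - c₀)⁻¹ • (V (z, c) - V (z, c₀)))
    (g := ξ) (g' := fun _ => V' (0, 1)) ?_ ?_ ?_
  · exact key
  · rw [Metric.tendstoUniformlyOnFilter_iff]
    intro e he
    -- Strict differentiability compares `V` at two moving points, so its difference quotients in
    -- the parameter converge uniformly for z near `z₀`.
    have h1 := (hasStrictFDerivAt_iff_isLittleO.mp hV).def (half_pos he)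
    have hcont : Tendsto (fun q : ℝ × ℝ => (((q.2, q.1), (q.2, c₀)) : (ℝ × ℝ) × (ℝ × ℝ)))
        (𝓝[≠] c₀ ×ˢ 𝓝 z₀) (𝓝 ((z₀, c₀), (z₀, c₀))) := by
      have h2 : Tendsto (fun q : ℝ × ℝ => q.1) (𝓝[≠] c₀ ×ˢ 𝓝 z₀) (𝓝 c₀) :=
        tendsto_fst.mono_right nhdsWithin_le_nhds
      have h3 : Tendsto (fun q : ℝ × ℝ => q.2) (𝓝[≠] c₀ ×ˢ 𝓝 z₀) (𝓝 z₀) := tendsto_snd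
      exact (h3.prodMk_nhds h2).prodMk_nhds (h3.prodMk_nhds tendsto_const_nhds)
    have hne : ∀ᶠ q in 𝓝[≠] c₀ ×ˢ 𝓝 z₀, q.1 ≠ c₀ :=
      (eventually_mem_nhdsWithin (a := c₀) (s := {c₀}ᶜ)).prod_inl _
    filter_upwards [hcont.eventually h1, hne] with q hq hqc
    have hpos : 0 < |q.1 - c₀| := abs_pos.mpr (sub_ne_zero.mpr hqc)
    have hlin : V' ((q.2, q.1) - (q.2, c₀)) = (q.1 - c₀) • V' (0, 1) := by
      rw [← map_smul]; simp
    simp only [hlin] at hq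
    have hnorm : ‖((q.2, q.1) - (q.2, c₀) : ℝ × ℝ)‖ = |q.1 - c₀| := by
      simp [Prod.norm_def]
    rw [hnorm] at hq
    rw [dist_comm, dist_eq_norm]
    have : (q.1 - c₀)⁻¹ • (V (q.2, q.1) - V (q.2, c₀)) - V' (0, 1)
        = (q.1 - c₀)⁻¹ • (V (q.2, q.1) - V (q.2, c₀) - (q.1 - c₀) • V' (0, 1)) := by
      rw [smul_sub _ _ ((q.1 - c₀) • V' (0, 1)), smul_smul,
        inv_mul_cancel₀ (sub_ne_zero.mpr hqc), one_smul]
    rw [this, norm_smul, norm_inv, Real.norm_eq_abs]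
    calc |q.1 - c₀|⁻¹ * ‖V (q.2, q.1) - V (q.2, c₀) - (q.1 - c₀) • V' (0, 1)‖
        ≤ |q.1 - c₀|⁻¹ * (e / 2 * |q.1 - c₀|) := by gcongr
      _ = e / 2 := by field_simp
      _ < e := half_lt_self he
  · have hcont : Tendsto (fun q : ℝ × ℝ => ((q.2, q.1) : ℝ × ℝ))
        (𝓝[≠] c₀ ×ˢ 𝓝 z₀) (𝓝 (z₀, c₀)) :=
      tendsto_snd.prodMk_nhds (tendsto_fst.mono_right nhdsWithin_le_nhds)
    have hcont' : Tendsto (fun q : ℝ × ℝ => ((q.2, c₀) : ℝ × ℝ))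
        (𝓝[≠] c₀ ×ˢ 𝓝 z₀) (𝓝 (z₀, c₀)) :=
      tendsto_snd.prodMk_nhds tendsto_const_nhds
    filter_upwards [hcont.eventually hU, hcont'.eventually hU] with q h1 h2
    exact (h1.sub h2).const_smul _
  · filter_upwards [hξ] with z hz
    have := hasDerivAt_iff_tendsto_slope.mp hz
    simpa [slope_fun_def, vsub_eq_sub] using this

/-! ### Damped equations and profiles -/

/-- One-sided bound for a bounded solution of a damped equation on a left half-line. -/
theorem damped_le {R S f f' : ℝ → ℝ} {z₁ σ G K : ℝ} (hσ : 0 < σ) (hG : 0 ≤ G)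
    (hR : ∀ z ≤ z₁, HasDerivAt R (R z * S z) z)
    (hS : ∀ z ≤ z₁, σ ≤ S z) (hR0 : Tendsto R atBot (𝓝 0))
    (hRpos : ∀ z ≤ z₁, 0 < R z)
    (hf : ∀ z ≤ z₁, HasDerivAt f (f' z) z) (hf' : ∀ z ≤ z₁, f' z ≤ -2 * S z * f z + G)
    (hK : ∀ z ≤ z₁, |f z| ≤ K) : ∀ z ≤ z₁, f z ≤ G / (2 * σ) := by
  intro z hz
  -- The weight R² turns the damping into monotonicity: h' ≥ R² (S G / σ - G) ≥ 0 because S ≥ σ.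
  -- Boundedness of f gives h → 0 at -∞, hence h ≥ 0.
  set h : ℝ → ℝ := fun y => R y ^ 2 * (G / (2 * σ) - f y) with hh
  have hder : ∀ y ≤ z₁, HasDerivAt h
      (2 * R y * (R y * S y) * (G / (2 * σ) - f y) + R y ^ 2 * (-f' y)) y := by
    intro y hy
    have := ((hR y hy).pow 2).mul ((hf y hy).const_sub (G / (2 * σ)))
    convert! this using 1
    simp
  have hmono : MonotoneOn h (Iic z₁) := by
    refine monotoneOn_of_hasDerivWithinAt_nonneg (convex_Iic _)
      (fun y hy => (hder y hy).continuousAt.continuousWithinAt)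
      (fun y hy => (hder y (mem_Iic.mp (interior_subset hy))).hasDerivWithinAt) ?_
    intro y hy
    have hy' : y ≤ z₁ := mem_Iic.mp (interior_subset hy)
    have h1 := hf' y hy'
    have h2 : G ≤ S y * (G / σ) := by
      calc G = σ * (G / σ) := by field_simp
        _ ≤ S y * (G / σ) := by
          have := hS y hy'
          gcongr
    have : 2 * R y * (R y * S y) * (G / (2 * σ) - f y) + R y ^ 2 * (-f' y)
        = R y ^ 2 * (S y * (G / σ) - 2 * S y * f y - f' y) := by
      field_simp
      ring
    rw [this]
    apply mul_nonneg (sq_nonneg _)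
    linarith
  have hlim : Tendsto h atBot (𝓝 0) := by
    have hb : ∀ᶠ y in atBot, |h y| ≤ R y ^ 2 * (G / (2 * σ) + K) := by
      filter_upwards [eventually_le_atBot z₁] with y hy
      rw [hh]
      simp only [abs_mul, abs_pow, sq_abs]
      gcongr
      calc |G / (2 * σ) - f y| ≤ |G / (2 * σ)| + |f y| := abs_sub _ _
        _ ≤ _ := by
          rw [abs_of_nonneg (by positivity)]
          have := hK y hy
          gcongr
    refine squeeze_zero_norm' hb ?_
    have := (hR0.pow 2).mul_const (G / (2 * σ) + K)
    simpa using this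
  have hnn : 0 ≤ h z := by
    refine le_of_tendsto hlim ?_
    filter_upwards [eventually_le_atBot z] with y hy
    exact hmono (mem_Iic.mpr (hy.trans hz)) (mem_Iic.mpr hz) hy
  have hp := hRpos z hz
  have := nonneg_of_mul_nonneg_right (a := R z ^ 2) hnn (by positivity)
  linarith

theorem damped_abs_le {R S f g : ℝ → ℝ} {z₁ σ G K : ℝ} (hσ : 0 < σ) (hG : 0 ≤ G)
    (hR : ∀ z ≤ z₁, HasDerivAt R (R z * S z) z)
    (hS : ∀ z ≤ z₁, σ ≤ S z) (hR0 : Tendsto R atBot (𝓝 0))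
    (hRpos : ∀ z ≤ z₁, 0 < R z)
    (hf : ∀ z ≤ z₁, HasDerivAt f (-2 * S z * f z + g z) z) (hg : ∀ z ≤ z₁, |g z| ≤ G)
    (hK : ∀ z ≤ z₁, |f z| ≤ K) : ∀ z ≤ z₁, |f z| ≤ G / (2 * σ) := by
  intro z hz
  rw [abs_le']
  refine ⟨damped_le hσ hG hR hS hR0 hRpos hf
    (fun y hy => by linarith [le_abs_self (g y), hg y hy]) hK z hz,
    damped_le (f := fun y => -f y) hσ hG hR hS hR0 hRpos (fun y hy => (hf y hy).neg)
      (fun y hy => by linarith [neg_abs_le (g y), hg y hy])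
      (fun y hy => by simpa using hK y hy) z hz⟩

/-- Uniform bounds on an amplitude-like pair `(R, S)` with `R' = R S`: `S` pushes `R` to zero on
both sides of `[-L, L]`, where `R` is at most `τ`. -/
structure Profile (R S : ℝ → ℝ) (L σ m B τ : ℝ) : Prop where
  L_pos : 0 < L
  σ_pos : 0 < σ
  m_pos : 0 < m
  τ_pos : 0 < τ
  pos : ∀ z, 0 < R z
  le : ∀ z, R z ≤ B
  abs_le : ∀ z, |S z| ≤ B
  lower : ∀ z, |z| ≤ L → m ≤ R z
  left : ∀ z ≤ -L, σ ≤ S z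
  right : ∀ z, L ≤ z → S z ≤ -σ
  tail_left : ∀ z ≤ -L, R z ≤ τ
  tail_right : ∀ z, L ≤ z → R z ≤ τ
  deriv : ∀ z, HasDerivAt R (R z * S z) z
  atBot : Tendsto R atBot (𝓝 0)
  atTop : Tendsto R atTop (𝓝 0)

namespace Profile

variable {R S : ℝ → ℝ} {L σ m B τ : ℝ}

theorem B_pos (h : Profile R S L σ m B τ) : 0 < B := (h.pos 0).trans_le (h.le 0)

theorem m_le_B (h : Profile R S L σ m B τ) : m ≤ B :=
  (h.lower 0 (by simpa using h.L_pos.le)).trans (h.le 0)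

theorem reflect (h : Profile R S L σ m B τ) :
    Profile (fun z => R (-z)) (fun z => -S (-z)) L σ m B τ where
  L_pos := h.L_pos
  σ_pos := h.σ_pos
  m_pos := h.m_pos
  τ_pos := h.τ_pos
  pos z := h.pos _
  le z := h.le _
  abs_le z := by simpa using h.abs_le (-z)
  lower z hz := h.lower _ (by simpa using hz)
  left z hz := by linarith [h.right (-z) (by linarith)]
  right z hz := by linarith [h.left (-z) (by linarith)]
  tail_left z hz := h.tail_right _ (by linarith)
  tail_right z hz := h.tail_left _ (by linarith)
  deriv z := by
    have := (h.deriv (-z)).scomp z (hasDerivAt_neg z)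
    convert! this using 1
    simp
  atBot := h.atTop.comp tendsto_neg_atBot_atTop
  atTop := h.atBot.comp tendsto_neg_atTop_atBot

/-- A bounded solution of `f' = -2 S f + g` is controlled by `g` on `(-∞, L]`. -/
theorem abs_le_of_damped (h : Profile R S L σ m B τ) {f g : ℝ → ℝ} {G K : ℝ} (hG : 0 ≤ G)
    (hf : ∀ z, HasDerivAt f (-2 * S z * f z + g z) z) (hg : ∀ z ≤ L, |g z| ≤ G)
    (hK : ∀ z ≤ -L, |f z| ≤ K) :
    ∀ z ≤ L, |f z| ≤ G * (B ^ 2 * (1 / (2 * σ) + 2 * L) / m ^ 2) := by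
  have hL := h.L_pos
  have hσ := h.σ_pos
  have hm := h.m_pos
  have hB := h.B_pos
  have hmB : m ^ 2 ≤ B ^ 2 := by gcongr; exact h.m_le_B
  have htail := damped_abs_le hσ hG (fun z _ => h.deriv z) h.left h.atBot (fun z _ => h.pos z)
    (fun z _ => hf z) (fun z hz => hg z (by linarith)) hK
  intro z hz
  rcases le_total z (-L) with hz' | hz'
  · calc |f z| ≤ G / (2 * σ) := htail z hz'
      _ = G * (m ^ 2 * (1 / (2 * σ)) / m ^ 2) := by field_simp
      _ ≤ _ := by
        gcongr
        linarith
  -- There is no damping to rely on here; R² f is integrated over a length of at most 2L and divided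
  -- by R² ≥ m². The lower bound m is the reason for stopping at L.
  · have hder : ∀ y, HasDerivAt (fun y => R y ^ 2 * f y) (R y ^ 2 * g y) y := by
      intro y
      have := ((h.deriv y).pow 2).mul (hf y)
      convert! this using 1
      simp
      ring
    have hmv := (convex_Icc (-L) L).norm_image_sub_le_of_norm_hasDerivWithin_le
      (f := fun y => R y ^ 2 * f y) (f' := fun y => R y ^ 2 * g y) (C := B ^ 2 * G)
      (fun y _ => (hder y).hasDerivWithinAt) (fun y hy => by
        rw [norm_mul, norm_pow, Real.norm_eq_abs, Real.norm_eq_abs, abs_of_pos (h.pos y)]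
        have := hg y hy.2
        have := h.le y
        have := h.pos y
        gcongr) (left_mem_Icc.mpr (by linarith)) ⟨hz', hz⟩
    simp only [Real.norm_eq_abs] at hmv
    have h1 : |R (-L) ^ 2 * f (-L)| ≤ B ^ 2 * (G / (2 * σ)) := by
      rw [abs_mul, abs_pow, abs_of_pos (h.pos _)]
      have := htail (-L) le_rfl
      have := h.le (-L)
      have := h.pos (-L)
      gcongr
    have h2 : |z - -L| ≤ 2 * L := by rw [abs_of_nonneg (by linarith)]; linarith
    have h3 : |R z ^ 2 * f z| ≤ G * (B ^ 2 * (1 / (2 * σ) + 2 * L)) := by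
      have h4 : B ^ 2 * G * |z - -L| ≤ B ^ 2 * G * (2 * L) := by gcongr
      have h5 := abs_sub_abs_le_abs_sub (R z ^ 2 * f z) (R (-L) ^ 2 * f (-L))
      have h6 : G * (B ^ 2 * (1 / (2 * σ) + 2 * L)) = B ^ 2 * (G / (2 * σ)) + B ^ 2 * G * (2 * L) := by
        field_simp
      linarith
    rw [abs_mul, abs_pow, abs_of_pos (h.pos z)] at h3
    have h7 : m ^ 2 * |f z| ≤ R z ^ 2 * |f z| := by
      have := h.lower z (_root_.abs_le.mpr ⟨hz', hz⟩)
      gcongr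
    rw [← mul_div_assoc, le_div_iff₀ (by positivity)]
    linarith

/-- The solvability condition behind the existence of a solitary wave bounds the coefficient of
the `R²` term by the remaining terms. -/
theorem coeff_le (h : Profile R S L σ m B τ) {f k : ℝ → ℝ} {e K D K' : ℝ} (he : 0 < e)
    (hD : 0 ≤ D) (hf : ∀ z, HasDerivAt f (-2 * S z * f z + e * (k z - D * R z ^ 2)) z)
    (hk : ∀ z, |k z| ≤ K) (hK' : ∀ z, |f z| ≤ K') :
    D ≤ B ^ 2 * K * (2 * L + 1 / σ) / (2 * L * m ^ 4) := by
  have hL := h.L_pos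
  have hσ := h.σ_pos
  have hm := h.m_pos
  have hB := h.B_pos
  have hK : 0 ≤ K := (abs_nonneg _).trans (hk 0)
  -- Dropping the term -D R² ≤ 0 leaves an upper bound free of D, and one-sided bounds at the two
  -- ends are all that is needed.
  have hle : ∀ z, e * (k z - D * R z ^ 2) ≤ e * K := fun z => by
    have h1 := (le_abs_self _).trans (hk z)
    have h2 : 0 ≤ D * R z ^ 2 := by positivity
    gcongr
    linarith
  have hl : f (-L) ≤ e * K / (2 * σ) :=
    damped_le hσ (by positivity) (fun z _ => h.deriv z) h.left h.atBot (fun z _ => h.pos z)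
      (fun z _ => hf z) (fun z _ => by linarith [hle z]) (fun z _ => hK' z) (-L) le_rfl
  -- The function -f(-z) solves the equation of the reflected profile with forcing of unchanged
  -- sign, so an upper bound for it is a lower bound for f(L).
  have h' := h.reflect
  have hr : -f (- -L) ≤ e * K / (2 * σ) :=
    damped_le (f := fun z => -f (-z)) hσ (by positivity) (fun z _ => h'.deriv z) h'.left h'.atBot
      (fun z _ => h'.pos z) (fun z _ => ((hf (-z)).scomp z (hasDerivAt_neg z)).neg)
      (fun z _ => by simp only [smul_eq_mul]; linarith [hle (-z)])
      (fun z _ => by simpa using hK' (-z)) (-L) le_rfl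
  rw [neg_neg] at hr
  have hder : ∀ y, HasDerivAt (fun y => R y ^ 2 * f y)
      (R y ^ 2 * (e * (k y - D * R y ^ 2))) y := by
    intro y
    have := ((h.deriv y).pow 2).mul (hf y)
    convert! this using 1
    simp
    ring
  have hmv := (convex_Icc (-L) L).image_sub_le_mul_sub_of_deriv_le
      (f := fun y => R y ^ 2 * f y) (C := e * (B ^ 2 * K - D * m ^ 4))
      (fun y _ => (hder y).continuousAt.continuousWithinAt)
      (fun y _ => (hder y).differentiableAt.differentiableWithinAt) (fun y hy => by
        rw [(hder y).deriv]
        have hy := interior_subset hy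
        have h1 := (le_abs_self _).trans (hk y)
        have h2 := h.lower y (_root_.abs_le.mpr hy)
        have h3 := h.le y
        have h4 := h.pos y
        have h5 : R y ^ 2 * k y ≤ B ^ 2 * K := by
          calc R y ^ 2 * k y ≤ R y ^ 2 * K := by gcongr
            _ ≤ B ^ 2 * K := by gcongr
        have h6 : D * m ^ 4 ≤ D * R y ^ 4 := by gcongr
        calc R y ^ 2 * (e * (k y - D * R y ^ 2)) = e * (R y ^ 2 * k y - D * R y ^ 4) := by ring
          _ ≤ _ := by gcongr) (-L) (left_mem_Icc.mpr (by linarith)) L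
            (right_mem_Icc.mpr (by linarith)) (by linarith)
  have hq : ∀ y, 0 ≤ e * K / (2 * σ) → f y ≤ e * K / (2 * σ) →
      R y ^ 2 * f y ≤ B ^ 2 * (e * K / (2 * σ)) := by
    intro y h0 hy
    have h3 := h.le y
    have h4 := h.pos y
    calc R y ^ 2 * f y ≤ R y ^ 2 * (e * K / (2 * σ)) := by gcongr
      _ ≤ _ := by gcongr
  have hq' : ∀ y, 0 ≤ e * K / (2 * σ) → -f y ≤ e * K / (2 * σ) →
      R y ^ 2 * -f y ≤ B ^ 2 * (e * K / (2 * σ)) := by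
    intro y h0 hy
    have h3 := h.le y
    have h4 := h.pos y
    calc R y ^ 2 * -f y ≤ R y ^ 2 * (e * K / (2 * σ)) := by gcongr
      _ ≤ _ := by gcongr
  have h1 := hq (-L) (by positivity) hl
  have h2 := hq' L (by positivity) hr
  have h3 : e * (D * (2 * L * m ^ 4)) ≤ e * (B ^ 2 * K * (2 * L + 1 / σ)) := by
    have : B ^ 2 * (e * K / (2 * σ)) + B ^ 2 * (e * K / (2 * σ)) = e * (B ^ 2 * K * (1 / σ)) := by
      field_simp; ring
    linarith
  rw [le_div_iff₀ (by positivity)]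
  exact le_of_mul_le_mul_left h3 he

end Profile

/-- The bound `K` serves only to make the supremum finite, so that it can be absorbed; it leaves no
trace in the conclusion. This removes the non-uniform constants of the families. -/
theorem le_two_mul_of_self_improving {ι : Type*} {f : ι → ℝ} {K c : ℝ} (hK : ∀ i, f i ≤ K)
    (h : ∀ N, (∀ i, f i ≤ N) → ∀ i, f i ≤ N / 2 + c) (i : ι) : f i ≤ 2 * c := by
  have hb : BddAbove (range f) := ⟨K, by rintro _ ⟨j, rfl⟩; exact hK j⟩
  have : Nonempty ι := ⟨i⟩
  have h1 : ⨆ j, f j ≤ (⨆ j, f j) / 2 + c := ciSup_le (h _ fun j => le_ciSup hb j)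
  linarith [le_ciSup hb i]

namespace Profile

variable {R S : ℝ → ℝ} {L σ m B τ : ℝ}

/-- On the left tail, a primitive multiplied by the amplitude is controlled by its derivative. -/
theorem abs_le_of_tail (h : Profile R S L σ m B τ) {x y : ℝ → ℝ} {N : ℝ}
    (hx : ∀ z, HasDerivAt x (S z * x z + R z * y z) z) (hxL : x (-L) = 0)
    (hy : ∀ z ≤ -L, |y z| ≤ N) : ∀ z ≤ -L, |x z| ≤ τ / σ * N := by
  intro z hz
  have hσ := h.σ_pos
  have hN : 0 ≤ N := (abs_nonneg _).trans (hy z hz)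
  -- Variation of constants: (x / R)' = y, so |x| grows at most like N R(z) (-L - z).
  have hder : ∀ t, HasDerivAt (fun t => x t / R t) (y t) t := by
    intro t
    have hne := (h.pos t).ne'
    have := (hx t).div (h.deriv t) hne
    convert! this using 1
    field_simp
    ring
  have hmv := (convex_Iic (-L)).norm_image_sub_le_of_norm_hasDerivWithin_le
    (f := fun t => x t / R t) (C := N) (fun t _ => (hder t).hasDerivWithinAt)
    (fun t ht => hy t ht) (mem_Iic.mpr hz) (mem_Iic.mpr le_rfl)
  -- The decay of R beats the linear growth of -L - t; comparison with the value at -L gives R(z)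
  -- (-L - z) ≤ τ / σ.
  have hmono : MonotoneOn (fun t => R t * (1 + σ * (-L - t))) (Iic (-L)) := by
    refine monotoneOn_of_hasDerivWithinAt_nonneg (convex_Iic _)
      (f' := fun t => R t * S t * (1 + σ * (-L - t)) + R t * (σ * (-1)))
      (fun t _ => ?_) (fun t _ => ?_) ?_
    · have := (h.deriv t).mul ((((hasDerivAt_id t).const_sub (-L)).const_mul σ).const_add 1)
      exact this.continuousAt.continuousWithinAt
    · exact ((h.deriv t).mul
        ((((hasDerivAt_id t).const_sub (-L)).const_mul σ).const_add 1)).hasDerivWithinAt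
    · intro t ht
      have ht : t ≤ -L := mem_Iic.mp (interior_subset ht)
      have h1 := h.left t ht
      have h2 := (h.pos t).le
      have h3 : 0 ≤ σ * (-L - t) := mul_nonneg hσ.le (by linarith)
      have : R t * S t * (1 + σ * (-L - t)) + R t * (σ * (-1))
          = R t * ((S t - σ) + S t * (σ * (-L - t))) := by ring
      rw [this]
      have h4 : 0 ≤ S t := hσ.le.trans h1
      have h5 : 0 ≤ S t - σ := by linarith
      positivity
  have h1 := hmono (mem_Iic.mpr hz) (mem_Iic.mpr le_rfl) hz
  simp only [sub_self, mul_zero, add_zero, mul_one] at h1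
  have h2 := h.tail_left (-L) le_rfl
  have hRz := h.pos z
  have h3 : R z * (-L - z) ≤ τ / σ := by
    rw [le_div_iff₀ hσ]
    nlinarith
  simp only [hxL, zero_div, zero_sub, norm_neg, Real.norm_eq_abs, abs_div,
    abs_of_pos hRz] at hmv
  rw [abs_of_nonneg (by linarith : 0 ≤ -L - z), div_le_iff₀ hRz] at hmv
  calc |x z| ≤ N * (-L - z) * R z := hmv
    _ = R z * (-L - z) * N := by ring
    _ ≤ _ := by gcongr

/-- A solution of the linearised system that is bounded at `-∞` and normalised at `-L` is bounded
on `(-∞, L]` in terms of the forcing. -/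
theorem linear_bound (h : Profile R S L σ m B τ) {x y w p q q' g k : ℝ → ℝ} {P Q G K : ℝ}
    (hQ : 0 ≤ Q)
    (hx : ∀ z, HasDerivAt x (S z * x z + R z * y z) z)
    (hy : ∀ z, HasDerivAt y (-2 * S z * y z + (p z * w z + q z * x z + g z)) z)
    (hw : ∀ z, HasDerivAt w (-2 * S z * w z + (-p z * y z + q' z * x z + k z)) z)
    (hp : ∀ z ≤ L, |p z| ≤ P) (hq : ∀ z ≤ L, |q z| ≤ Q * R z) (hq' : ∀ z ≤ L, |q' z| ≤ Q * R z)
    (hg : ∀ z ≤ L, |g z| ≤ G) (hk : ∀ z ≤ L, |k z| ≤ G)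
    (hsmall : P + Q * τ * (τ / σ) ≤ σ) (hxL : x (-L) = 0)
    (hK : ∀ z ≤ -L, |y z| ≤ K ∧ |w z| ≤ K) :
    ∀ z ≤ L, ‖(x z, y z, w z)‖ ≤
      gronwallBound (max (τ / σ * (G / σ)) (G / σ)) (2 * B + P + Q * B) G (2 * L) := by
  have hL := h.L_pos
  have hσ := h.σ_pos
  have hτ := h.τ_pos
  have hB := h.B_pos
  have hP : 0 ≤ P := (abs_nonneg _).trans (hp L le_rfl)
  have hG : 0 ≤ G := (abs_nonneg _).trans (hg L le_rfl)
  have hLL : ∀ z, z ≤ -L → z ≤ L := fun z hz => by linarith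
  -- The coupling contributes at most (P + Qτ · τ/σ) N ≤ σ N to the forcing, and the damped estimate
  -- divides by 2σ: this is the factor 1/2.
  have step : ∀ N, (∀ z : Iic (-L), max |y z| |w z| ≤ N) →
      ∀ z : Iic (-L), max |y z| |w z| ≤ N / 2 + G / (2 * σ) := by
    intro N hN
    have hN' : ∀ z ≤ -L, |y z| ≤ N ∧ |w z| ≤ N := fun z hz => max_le_iff.mp (hN ⟨z, hz⟩)
    have hxN := h.abs_le_of_tail hx hxL (fun z hz => (hN' z hz).1)
    have hN0 : 0 ≤ N := (abs_nonneg _).trans (hN' (-L) le_rfl).1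
    have est : ∀ z ≤ -L, ∀ p' v r f : ℝ, |p'| ≤ P → |v| ≤ N → |r| ≤ Q * R z → |f| ≤ G →
        |p' * v + r * x z + f| ≤ σ * N + G := by
      intro z hz p' v r f h1 h2 h3 h4
      have h5 := h.tail_left z hz
      have h6 := hxN z hz
      calc |p' * v + r * x z + f| ≤ |p'| * |v| + |r| * |x z| + |f| := by
            rw [← abs_mul, ← abs_mul]
            exact abs_add_three _ _ _
        _ ≤ P * N + (Q * τ) * (τ / σ * N) + G := by
            have : |r| ≤ Q * τ := h3.trans (by gcongr)
            gcongr
        _ = (P + Q * τ * (τ / σ)) * N + G := by ring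
        _ ≤ _ := by gcongr
    have hG' : 0 ≤ σ * N + G := by positivity
    have hy' := damped_abs_le hσ hG' (fun z _ => h.deriv z) h.left h.atBot (fun z _ => h.pos z)
      (fun z _ => hy z) (fun z hz => est z hz _ _ _ _ (hp z (hLL z hz)) (hN' z hz).2
        (hq z (hLL z hz)) (hg z (hLL z hz))) (fun z hz => (hN' z hz).1)
    have hw' := damped_abs_le hσ hG' (fun z _ => h.deriv z) h.left h.atBot (fun z _ => h.pos z)
      (fun z _ => hw z) (fun z hz => est z hz _ _ _ _ (by simpa using hp z (hLL z hz))
        (hN' z hz).1 (hq' z (hLL z hz)) (hk z (hLL z hz))) (fun z hz => (hN' z hz).2)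
    have heq : (σ * N + G) / (2 * σ) = N / 2 + G / (2 * σ) := by field_simp
    rw [heq] at hy' hw'
    exact fun z => max_le (hy' z z.2) (hw' z z.2)
  have tail := le_two_mul_of_self_improving
    (fun z : Iic (-L) => max_le (hK z z.2).1 (hK z z.2).2) step
  have heq : 2 * (G / (2 * σ)) = G / σ := by field_simp
  have tail' : ∀ z ≤ -L, |y z| ≤ G / σ ∧ |w z| ≤ G / σ := fun z hz => by
    have := tail ⟨z, hz⟩
    rw [heq] at this
    exact max_le_iff.mp this
  have tailx := h.abs_le_of_tail hx hxL (fun z hz => (tail' z hz).1)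
  have tailn : ∀ z ≤ -L, ‖(x z, y z, w z)‖ ≤ max (τ / σ * (G / σ)) (G / σ) := fun z hz =>
    max_le ((tailx z hz).trans (le_max_left _ _))
      ((max_le (tail' z hz).1 (tail' z hz).2).trans (le_max_right _ _))
  have hδ : 0 ≤ max (τ / σ * (G / σ)) (G / σ) := (norm_nonneg _).trans (tailn (-L) le_rfl)
  have hmono := gronwallBound_mono (K := 2 * B + P + Q * B) hδ hG (by positivity)
  intro z hz
  rcases le_total z (-L) with hz' | hz'
  · refine (tailn z hz').trans ?_
    have := hmono (show (0 : ℝ) ≤ 2 * L by positivity)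
    rwa [gronwallBound_x0] at this
  · have hder : ∀ t, HasDerivAt (fun t => (x t, y t, w t)) (S t * x t + R t * y t,
        -2 * S t * y t + (p t * w t + q t * x t + g t),
        -2 * S t * w t + (-p t * y t + q' t * x t + k t)) t :=
      fun t => (hx t).prodMk ((hy t).prodMk (hw t))
    -- Beyond the tail the coupling is no longer small; a crude growth rate suffices because the
    -- interval has the fixed length 2L.
    have hgr := norm_le_gronwallBound_of_norm_deriv_right_le (a := -L) (b := L)
      (f := fun t => (x t, y t, w t)) (K := 2 * B + P + Q * B) (ε := G)
      (fun t _ => (hder t).continuousAt.continuousWithinAt)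
      (fun t _ => (hder t).hasDerivWithinAt) (tailn (-L) le_rfl) (fun t ht => ?_) z ⟨hz', hz⟩
    · refine hgr.trans (hmono ?_)
      linarith
    · set n := ‖(x t, y t, w t)‖ with hn
      have hn0 : 0 ≤ n := norm_nonneg _
      have hxn : |x t| ≤ n := le_max_left _ _
      have hyn : |y t| ≤ n := (le_max_left _ _).trans (le_max_right _ _)
      have hwn : |w t| ≤ n := (le_max_right _ _).trans (le_max_right _ _)
      have hS := h.abs_le t
      have hRB := h.le t
      have hR0 := h.pos t
      have est : ∀ p' u v r f : ℝ, |p'| ≤ P → |u| ≤ n → |v| ≤ n → |r| ≤ Q * R t → |f| ≤ G →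
          |-2 * S t * u + (p' * v + r * x t + f)| ≤ (2 * B + P + Q * B) * n + G := by
        intro p' u v r f h1 hu h2 h3 h4
        calc |-2 * S t * u + (p' * v + r * x t + f)|
            ≤ |-2 * S t * u| + (|p' * v| + |r * x t| + |f|) :=
              (abs_add_le _ _).trans (by gcongr; exact abs_add_three _ _ _)
          _ = 2 * |S t| * |u| + (|p'| * |v| + |r| * |x t| + |f|) := by
              simp [abs_mul]
          _ ≤ 2 * B * n + (P * n + (Q * B) * n + G) := by
              have : |r| ≤ Q * B := h3.trans (by gcongr)
              gcongr
          _ = _ := by ring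
      refine max_le ?_ (max_le ?_ ?_)
      · calc |S t * x t + R t * y t| ≤ |S t * x t| + |R t * y t| := abs_add_le _ _
          _ = |S t| * |x t| + R t * |y t| := by rw [abs_mul, abs_mul, abs_of_pos hR0]
          _ ≤ B * n + B * n := by gcongr
          _ ≤ (2 * B + P + Q * B) * n + G := by
              have : 0 ≤ P * n + Q * B * n := by positivity
              linarith
      · exact est _ _ _ _ _ (hp t ht.2.le) hyn hwn (hq t ht.2.le) (hg t ht.2.le)
      · exact est _ _ _ _ _ (by simpa using hp t ht.2.le) hwn hyn (hq' t ht.2.le) (hk t ht.2.le)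

end Profile

/-! ### The linearised field -/

theorem Coeffs.Δ_pos (p : Coeffs) : 0 < p.Δ := by
  unfold Coeffs.Δ; positivity

/-- Coefficient of `δr` in the linearised equation for `δs`. -/
def Coeffs.qs (p : Coeffs) (r : ℝ) : ℝ :=
  -(2 * (1 + p.ε ^ 2 * p.a * p.d₁) * r + 4 * (p.α + p.ε ^ 2 * p.a * p.d₂) * r ^ 3) / p.Δ

/-- Coefficient of `δr` in the linearised equation for `δφ`. -/
def Coeffs.qφ (p : Coeffs) (r : ℝ) : ℝ :=
  -(p.ε * (2 * (p.d₁ - p.a) * r + 4 * (p.d₂ - p.a * p.α) * r ^ 3)) / p.Δ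

/-- Derivative of the field at speed `0` and state `u` in the direction `(k, η)`. -/
def Coeffs.linearized (p : Coeffs) (k : ℝ) (u η : State) : State :=
  (u.2.1 * η.1 + u.1 * η.2.1,
   -2 * u.2.1 * η.2.1
    + (2 * u.2.2 * η.2.2 + p.qs u.1 * η.1 + k * (-(p.ε * p.a * u.2.1 - u.2.2) / p.Δ)),
   -2 * u.2.1 * η.2.2
    + (-(2 * u.2.2) * η.2.1 + p.qφ u.1 * η.1 + k * (-(u.2.1 + p.ε * p.a * u.2.2) / p.Δ)))

/-- A curve in (speed, state) covers both uses: constant speed gives the equation of ξ₁ (k = 0), and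
varying the speed at fixed z gives that of ξ₂ (k = 1). -/
theorem Coeffs.hasDerivAt_field (p : Coeffs) (ω : ℝ) {γ : ℝ → ℝ} {u : ℝ → State} {k t : ℝ}
    {η : State} (hγ : HasDerivAt γ k t) (hu : HasDerivAt u η t) (h0 : γ t = 0) :
    HasDerivAt (fun t => p.field ω (γ t) (u t)) (p.linearized k (u t) η) t := by
  have hΔ := p.Δ_pos.ne'
  have hr : HasDerivAt (fun t => (u t).1) η.1 t := hu.fst
  have hs : HasDerivAt (fun t => (u t).2.1) η.2.1 t := hu.snd.fst
  have hf : HasDerivAt (fun t => (u t).2.2) η.2.2 t := hu.snd.snd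
  refine (?_ : HasDerivAt (fun t => (u t).1 * (u t).2.1) _ t).prodMk
    (HasDerivAt.prodMk ?_ ?_)
  · convert! hr.mul hs using 1
    ring
  · have := (((((hs.pow 2).const_mul (-p.Δ)).add ((hf.pow 2).const_mul p.Δ)).sub
      (hγ.mul ((hs.const_mul (p.ε * p.a)).sub hf))).sub_const (-ω + p.ε ^ 2 * p.a * p.b)).sub
      ((hr.pow 2).const_mul (1 + p.ε ^ 2 * p.a * p.d₁)) |>.sub
      ((hr.pow 4).const_mul (p.α + p.ε ^ 2 * p.a * p.d₂)) |>.div_const p.Δ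
    convert! this using 1
    simp only [Coeffs.qs, h0]
    field_simp
    simp
    ring
  · have := ((((hs.const_mul (-2 * p.Δ)).mul hf).sub (hγ.mul (hs.add (hf.const_mul (p.ε * p.a))))).sub
      ((((hr.pow 2).const_mul (p.d₁ - p.a)).const_add (p.b + p.a * ω)).add
        ((hr.pow 4).const_mul (p.d₂ - p.a * p.α)) |>.const_mul p.ε)).div_const p.Δ
    convert! this using 1
    simp only [Coeffs.qφ, h0]
    field_simp
    simp
    ring

theorem Coeffs.contDiff_field (p : Coeffs) (ω : ℝ) :
    ContDiff ℝ 1 (fun q : ℝ × State => p.field ω q.1 q.2) := by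
  unfold Coeffs.field
  fun_prop

/-! ### Reversal symmetry between the stable and unstable sides -/

/-- The reflection `(r, s, φ) ↦ (r, -s, -φ)`. -/
def reflection : State →L[ℝ] State :=
  (ContinuousLinearMap.fst ℝ ℝ (ℝ × ℝ)).prod (-ContinuousLinearMap.snd ℝ ℝ (ℝ × ℝ))

theorem reflection_apply (u : State) : reflection u = (u.1, -u.2.1, -u.2.2) := rfl

theorem Coeffs.field_reflection (p : Coeffs) (ω c : ℝ) (u : State) :
    p.field ω c (reflection u) = -reflection (p.field ω (-c) u) := by
  simp only [Coeffs.field, reflection_apply]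
  refine Prod.ext ?_ (Prod.ext ?_ ?_)
  · simp
  · simp only [Prod.neg_mk]
    ring
  · simp only [Prod.neg_mk]
    ring

theorem hasDerivAt_reflect {u : ℝ → State} {v : State} {z : ℝ} (h : HasDerivAt u v (-z)) :
    HasDerivAt (fun z => reflection (u (-z))) (-reflection v) z := by
  have := reflection.hasFDerivAt.comp_hasDerivAt z (h.scomp z (hasDerivAt_neg z))
  convert! this using 1
  simp

theorem EmanatesFromZero.of_decays {u : ℝ → State} (h : DecaysToZero u) :
    EmanatesFromZero (fun z => reflection (u (-z))) := by
  obtain ⟨s₀, φ₀, hs, h⟩ := h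
  refine ⟨-s₀, -φ₀, by linarith, ?_⟩
  exact (reflection.continuous.tendsto _).comp (h.comp tendsto_neg_atBot_atTop)

theorem DecaysToZero.of_emanates {u : ℝ → State} (h : EmanatesFromZero u) :
    DecaysToZero (fun z => reflection (u (-z))) := by
  obtain ⟨s₀, φ₀, hs, h⟩ := h
  refine ⟨-s₀, -φ₀, by linarith, ?_⟩
  exact (reflection.continuous.tendsto _).comp (h.comp tendsto_neg_atTop_atBot)

theorem Coeffs.IsSolitaryWave.reflect {p : Coeffs} {ω : ℝ} {u : ℝ → State}
    (h : p.IsSolitaryWave ω u) : p.IsSolitaryWave ω (fun z => reflection (u (-z))) where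
  solves z _ := by
    obtain ⟨h1, h2⟩ := h.solves (-z) trivial
    refine ⟨h1, ?_⟩
    have := hasDerivAt_reflect h2
    have hf := p.field_reflection ω 0 (u (-z))
    rw [neg_zero] at hf
    rwa [← hf] at this
  emanates := EmanatesFromZero.of_decays h.decays
  decays := DecaysToZero.of_emanates h.emanates

/-- Reversing the speed adds a sign to the reflection. The combined map negates δr but fixes δs and
δφ, so the value -1/2 of the phase component is the same on both sides. -/
theorem Coeffs.IsStableFamily.ξ₂_reflect {p : Coeffs} {ω : ℝ} {u : ℝ → State}
    {W : ℝ → ℝ → State} (h : p.IsStableFamily ω u W) (z : ℝ) :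
    ξ₂ (fun z c => reflection (W (-z) (-c))) z = -reflection (ξ₂ W (-z)) := by
  have hdiff : DifferentiableAt ℝ (fun c => W (-z) c) (-0) := by
    obtain ⟨δ, hδ, hreg, -⟩ := h.regular (-z - 1)
    have hopen : Ioi (-z - 1) ×ˢ Ioo (-δ) δ ∈ 𝓝 ((-z, -0) : ℝ × ℝ) :=
      (isOpen_Ioi.prod isOpen_Ioo).mem_nhds ⟨by simp, by simpa using hδ⟩
    have := (hreg.contDiffAt hopen).differentiableAt one_ne_zero
    exact this.comp (-0 : ℝ) (f := fun c : ℝ => (-z, c)) (by fun_prop)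
  have hd := reflection.hasFDerivAt.comp_hasDerivAt 0
    (hdiff.hasDerivAt.scomp 0 (hasDerivAt_neg (0 : ℝ)))
  have h1 : ξ₂ (fun z c => reflection (W (-z) (-c))) z = _ := hd.deriv
  simpa [ξ₂] using h1

theorem Coeffs.IsStableFamily.reflect {p : Coeffs} {ω : ℝ} {u : ℝ → State} {W : ℝ → ℝ → State}
    (h : p.IsStableFamily ω u W) :
    p.IsUnstableFamily ω (fun z => reflection (u (-z)))
      (fun z c => reflection (W (-z) (-c))) where
  base z := by simp [h.base]
  regular L := by
    obtain ⟨δ, hδ, hreg, hsol⟩ := h.regular (-L)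
    refine ⟨δ, hδ, ?_, fun c hc => ?_⟩
    · have hneg : ContDiff ℝ 1 (fun q : ℝ × ℝ => (-q.1, -q.2)) := by fun_prop
      exact reflection.contDiff.comp_contDiffOn (hreg.comp hneg.contDiffOn
        (fun q hq => ⟨neg_lt_neg (mem_Iio.mp hq.1), neg_lt_neg hq.2.2, neg_lt.mp hq.2.1⟩))
    · obtain ⟨h1, h2⟩ := hsol (-c) ⟨neg_lt_neg hc.2, neg_lt.mp hc.1⟩
      refine ⟨fun z hz => ?_, EmanatesFromZero.of_decays h2⟩
      obtain ⟨h3, h4⟩ := h1 (-z) (neg_lt_neg (mem_Iio.mp hz))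
      refine ⟨h3, ?_⟩
      have := hasDerivAt_reflect h4
      rwa [← p.field_reflection] at this
  bounded := by
    obtain ⟨K, hK⟩ := h.bounded
    refine ⟨‖reflection‖ * K, fun z hz => ?_⟩
    have := h.ξ₂_reflect z
    rw [ξ₂] at this
    rw [this, norm_neg]
    refine (reflection.le_opNorm _).trans ?_
    have := hK (-z) (by linarith)
    rw [← ξ₂] at this
    gcongr

/-! ### Variational equations along the unstable family -/

namespace Coeffs.IsUnstableFamily

variable {p : Coeffs} {ω : ℝ} {u : ℝ → State} {W : ℝ → ℝ → State}

theorem solves (h : p.IsUnstableFamily ω u W) (z : ℝ) :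
    0 < (u z).1 ∧ HasDerivAt u (p.field ω 0 (u z)) z := by
  obtain ⟨δ, hδ, -, hsol⟩ := h.regular (z + 1)
  have := (hsol 0 ⟨by linarith, hδ⟩).1 z (by simp)
  have hW : (fun z => W z 0) = u := funext h.base
  simpa only [hW, h.base] using this

theorem contDiffAt (h : p.IsUnstableFamily ω u W) (z : ℝ) :
    ContDiffAt ℝ 1 (fun q : ℝ × ℝ => W q.1 q.2) (z, 0) := by
  obtain ⟨δ, hδ, hreg, -⟩ := h.regular (z + 1)
  exact hreg.contDiffAt ((isOpen_Iio.prod isOpen_Ioo).mem_nhds ⟨by simp, by simpa using hδ⟩)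

theorem hasDerivAt_speed (h : p.IsUnstableFamily ω u W) (z : ℝ) :
    HasDerivAt (fun c => W z c) (ξ₂ W z) 0 := by
  have := (h.contDiffAt z).differentiableAt one_ne_zero
  exact (this.comp (0 : ℝ) (f := fun c : ℝ => (z, c)) (by fun_prop)).hasDerivAt

theorem ξ₁_eq (h : p.IsUnstableFamily ω u W) (z : ℝ) : ξ₁ W z = p.field ω 0 (u z) := by
  have hW : (fun z => W z 0) = u := funext h.base
  rw [ξ₁, hW]
  exact (h.solves z).2.deriv

theorem hasDerivAt_ξ₁ (h : p.IsUnstableFamily ω u W) (z : ℝ) :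
    HasDerivAt (ξ₁ W) (p.linearized 0 (u z) (ξ₁ W z)) z := by
  rw [h.ξ₁_eq, show ξ₁ W = fun z => p.field ω 0 (u z) from funext h.ξ₁_eq]
  exact p.hasDerivAt_field ω (hasDerivAt_const z 0) (h.solves z).2 rfl

/-- `W` is only C¹, so mixed partials cannot be interchanged by second-order smoothness. But ∂_z W
is the field composed with `W`, which is again C¹, and `hasDerivAt_param_deriv` applies. -/
theorem hasDerivAt_ξ₂ (h : p.IsUnstableFamily ω u W) (z : ℝ) :
    HasDerivAt (ξ₂ W) (p.linearized 1 (u z) (ξ₂ W z)) z := by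
  have hV : ContDiffAt ℝ 1 (fun q : ℝ × ℝ => p.field ω q.2 (W q.1 q.2)) (z, 0) :=
    (p.contDiff_field ω).contDiffAt.comp (z, (0 : ℝ)) (contDiffAt_snd.prodMk (h.contDiffAt z))
  have hVs := hV.hasStrictFDerivAt one_ne_zero
  have key := hasDerivAt_param_deriv (U := fun q : ℝ × ℝ => W q.1 q.2) (ξ := ξ₂ W) hVs ?_
    (Eventually.of_forall h.hasDerivAt_speed)
  · have h1 : HasDerivAt (fun c => p.field ω c (W z c))
        (p.linearized 1 (W z 0) (ξ₂ W z)) 0 :=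
      p.hasDerivAt_field ω (hasDerivAt_id 0) (h.hasDerivAt_speed z) rfl
    have h2 := hVs.hasFDerivAt.comp_hasDerivAt (0 : ℝ) (f := fun c : ℝ => (z, c))
      ((hasDerivAt_const (0 : ℝ) z).prodMk (hasDerivAt_id (0 : ℝ)))
    rw [h.base] at h1
    rwa [h2.unique h1] at key
  · obtain ⟨δ, hδ, -, hsol⟩ := h.regular (z + 1)
    have hopen : Iio (z + 1) ×ˢ Ioo (-δ) δ ∈ 𝓝 ((z, 0) : ℝ × ℝ) :=
      (isOpen_Iio.prod isOpen_Ioo).mem_nhds ⟨by simp, by simpa using hδ⟩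
    filter_upwards [hopen] with q hq
    exact ((hsol q.2 hq.2).1 q.1 hq.1).2

end Coeffs.IsUnstableFamily

/-! ### The unperturbed wave and profiles near it -/

section UnperturbedWave

variable {α ω : ℝ}

/-- The denominator of `R₀²`. -/
def den (α ω z : ℝ) : ℝ := 1 + √(1 - β α ω) * Real.cosh (2 * √ω * z)

theorem one_le_den (z : ℝ) : 1 ≤ den α ω z := by
  have := mul_nonneg (Real.sqrt_nonneg (1 - β α ω)) (Real.cosh_pos (2 * √ω * z)).le
  unfold den
  linarith

theorem R₀_eq (z : ℝ) : R₀ α ω z = √(4 * ω / den α ω z) := rfl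

theorem R₀_pos (hω : 0 < ω) (z : ℝ) : 0 < R₀ α ω z := by
  have := one_le_den (α := α) (ω := ω) z
  rw [R₀_eq]
  positivity

theorem R₀_le (hω : 0 < ω) (z : ℝ) : R₀ α ω z ≤ 2 * √ω := by
  have h := one_le_den (α := α) (ω := ω) z
  rw [R₀_eq, Real.sqrt_le_left (by positivity), mul_pow, Real.sq_sqrt hω.le]
  rw [div_le_iff₀ (by linarith)]
  nlinarith

theorem R₀_neg (z : ℝ) : R₀ α ω (-z) = R₀ α ω z := by
  simp [R₀]

theorem hasDerivAt_R₀ (hω : 0 < ω) (z : ℝ) :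
    HasDerivAt (R₀ α ω) (R₀ α ω z *
      (-(√ω * (√(1 - β α ω) * Real.sinh (2 * √ω * z))) / den α ω z)) z := by
  have h := one_le_den (α := α) (ω := ω) z
  have hd : 0 < den α ω z := by linarith
  have hden : HasDerivAt (den α ω) (√(1 - β α ω) * (Real.sinh (2 * √ω * z) * (2 * √ω))) z := by
    have := ((Real.hasDerivAt_cosh (2 * √ω * z)).comp z
      ((hasDerivAt_id z).const_mul (2 * √ω))).const_mul (√(1 - β α ω)) |>.const_add 1
    convert! this using 1
    simp
  have hq : 0 < 4 * ω / den α ω z := by positivity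
  have := ((hasDerivAt_const z (4 * ω)).div hden hd.ne').sqrt hq.ne'
  convert! this using 1
  have hR : R₀ α ω z ≠ 0 := (R₀_pos hω z).ne'
  have hsq : R₀ α ω z ^ 2 = 4 * ω / den α ω z := by rw [R₀_eq, Real.sq_sqrt hq.le]
  simp only [Pi.div_apply, ← R₀_eq]
  rw [eq_div_iff (by positivity)]
  have : R₀ α ω z * (-(√ω * (√(1 - β α ω) * Real.sinh (2 * √ω * z))) / den α ω z)
      * (2 * R₀ α ω z) = R₀ α ω z ^ 2 * 2 *
      (-(√ω * (√(1 - β α ω) * Real.sinh (2 * √ω * z))) / den α ω z) := by ring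
  rw [this, hsq]
  field_simp
  ring

theorem S₀_eq (hω : 0 < ω) (z : ℝ) :
    S₀ α ω z = -(√ω * (√(1 - β α ω) * Real.sinh (2 * √ω * z))) / den α ω z := by
  rw [S₀, (hasDerivAt_R₀ hω z).deriv, mul_div_cancel_left₀ _ (R₀_pos hω z).ne']

theorem S₀_neg (hω : 0 < ω) (z : ℝ) : S₀ α ω (-z) = -S₀ α ω z := by
  simp [S₀_eq hω, den, neg_div]

theorem wave₀_neg (hω : 0 < ω) (z : ℝ) : wave₀ α ω (-z) = reflection (wave₀ α ω z) := by
  simp [wave₀, reflection_apply, R₀_neg, S₀_neg hω]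

theorem abs_S₀_le (hω : 0 < ω) (z : ℝ) : |S₀ α ω z| ≤ √ω := by
  have h := one_le_den (α := α) (ω := ω) z
  have hd : 0 < den α ω z := by linarith
  rw [S₀_eq hω, abs_div, abs_neg, abs_mul, abs_mul, abs_of_nonneg (Real.sqrt_nonneg _),
    abs_of_nonneg (Real.sqrt_nonneg _), abs_of_pos hd, div_le_iff₀ hd]
  have h1 : |Real.sinh (2 * √ω * z)| ≤ Real.cosh (2 * √ω * z) := by
    rw [abs_le']
    exact ⟨(Real.sinh_lt_cosh _).le, by
      rw [← Real.sinh_neg, ← Real.cosh_neg]; exact (Real.sinh_lt_cosh _).le⟩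
  gcongr
  have : √(1 - β α ω) * |Real.sinh (2 * √ω * z)| ≤ √(1 - β α ω) * Real.cosh (2 * √ω * z) := by
    gcongr
  unfold den
  linarith

theorem tendsto_cosh_wave (hω : 0 < ω) :
    Tendsto (fun z => Real.cosh (2 * √ω * z)) atTop atTop := by
  have h1 : Tendsto (fun z => Real.exp (2 * √ω * z) / 2) atTop atTop :=
    (Real.tendsto_exp_atTop.comp (tendsto_id.const_mul_atTop (by positivity))).atTop_div_const
      two_pos
  refine tendsto_atTop_mono (fun z => ?_) h1
  rw [Real.cosh_eq]
  have := Real.exp_pos (-(2 * √ω * z))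
  linarith

theorem tendsto_R₀_atTop (hω : 0 < ω) (hβ : β α ω < 1) : Tendsto (R₀ α ω) atTop (𝓝 0) := by
  have hk : 0 < √(1 - β α ω) := Real.sqrt_pos.mpr (by linarith)
  have h1 : Tendsto (den α ω) atTop atTop :=
    tendsto_atTop_add_const_left _ _ ((tendsto_cosh_wave hω).const_mul_atTop hk)
  have h2 : Tendsto (fun z => 4 * ω / den α ω z) atTop (𝓝 0) := h1.const_div_atTop _
  have := (Real.continuous_sqrt.tendsto 0).comp h2
  rwa [Real.sqrt_zero] at this

theorem eventually_S₀_le (hω : 0 < ω) (hβ : β α ω < 1) :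
    ∀ᶠ z in atTop, S₀ α ω z ≤ -(3 / 4 * √ω) := by
  have hk : 0 < √(1 - β α ω) := Real.sqrt_pos.mpr (by linarith)
  have hs : 0 < √ω := Real.sqrt_pos.mpr hω
  -- With k = √(1 - β) and sinh ≥ cosh - 1, the claim reduces to 3/4 (1 + k cosh) ≤ k (cosh - 1),
  -- that is cosh ≥ 4 + 3/k.
  filter_upwards [(tendsto_cosh_wave hω).eventually_ge_atTop (4 + 3 / √(1 - β α ω)),
    eventually_ge_atTop 0] with z hz hz0
  have hd : 0 < den α ω z := by linarith [one_le_den (α := α) (ω := ω) z]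
  rw [S₀_eq hω, neg_div, neg_le_neg_iff, le_div_iff₀ hd]
  have h1 : Real.cosh (2 * √ω * z) - 1 ≤ Real.sinh (2 * √ω * z) := by
    have := Real.cosh_sub_sinh (2 * √ω * z)
    have h2 : Real.exp (-(2 * √ω * z)) ≤ 1 := Real.exp_le_one_iff.mpr (by
      have : 0 ≤ 2 * √ω * z := by positivity
      linarith)
    linarith
  have h2 : 4 * √(1 - β α ω) + 3 ≤ √(1 - β α ω) * Real.cosh (2 * √ω * z) := by
    have := mul_le_mul_of_nonneg_left hz hk.le
    have h3 : √(1 - β α ω) * (4 + 3 / √(1 - β α ω)) = 4 * √(1 - β α ω) + 3 := by field_simp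
    linarith
  have h3 : √(1 - β α ω) * (Real.cosh (2 * √ω * z) - 1) ≤
      √(1 - β α ω) * Real.sinh (2 * √ω * z) := by gcongr
  have h4 : 3 / 4 * den α ω z ≤ √(1 - β α ω) * Real.sinh (2 * √ω * z) := by
    unfold den; linarith
  calc 3 / 4 * √ω * den α ω z = √ω * (3 / 4 * den α ω z) := by ring
    _ ≤ _ := by gcongr

theorem R₀_ge (hω : 0 < ω) {L z : ℝ} (hz : |z| ≤ L) : R₀ α ω L ≤ R₀ α ω z := by
  have h := one_le_den (α := α) (ω := ω) z
  rw [R₀_eq, R₀_eq]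
  have h1 : den α ω z ≤ den α ω L := by
    unfold den
    gcongr
    rw [Real.cosh_le_cosh, abs_mul _ z, abs_mul _ L]
    have : |z| ≤ |L| := hz.trans (le_abs_self L)
    gcongr
  gcongr

/-- Waves uniformly close to the unperturbed one are profiles with common constants, for which
the tail amplitude `τ` may be prescribed. -/
theorem exists_profile (hω : 0 < ω) (hβ : β α ω < 1) {τ : ℝ} (hτ : 0 < τ) (M : ℝ) :
    ∃ L m e : ℝ, M ≤ L ∧ 0 < e ∧ ∀ (p : Coeffs) (u : ℝ → State), p.IsSolitaryWave ω u →
      (∀ z, dist (wave₀ α ω z) (u z) < e) →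
      Profile (fun z => (u z).1) (fun z => (u z).2.1) L (√ω / 2) m (2 * √ω + 1) τ ∧
        ∀ z, |(u z).2.2| ≤ τ := by
  have hs : 0 < √ω := Real.sqrt_pos.mpr hω
  obtain ⟨N, hN⟩ := eventually_atTop.mp ((eventually_S₀_le hω hβ).and
    ((tendsto_R₀_atTop hω hβ).eventually_le_const (half_pos hτ)))
  set L := max (max M N) 1 with hL
  have hNL : N ≤ L := (le_max_right _ _).trans (le_max_left _ _)
  have hm := R₀_pos (α := α) hω L
  have hright : ∀ z, L ≤ z → S₀ α ω z ≤ -(3 / 4 * √ω) ∧ R₀ α ω z ≤ τ / 2 :=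
    fun z hz => hN z (hNL.trans hz)
  have hleft : ∀ z ≤ -L, 3 / 4 * √ω ≤ S₀ α ω z ∧ R₀ α ω z ≤ τ / 2 := by
    intro z hz
    have := hright (-z) (by linarith)
    rw [S₀_neg hω, R₀_neg] at this
    exact ⟨by linarith, this.2⟩
  -- One tolerance per requirement: `R₀ α ω L / 2` for the lower bound m, τ/2 for the tail
  -- amplitude, 1 for the upper bound 2√ω + 1, and √ω/4 to keep |S| ≥ √ω/2 on the tails, where |S₀|
  -- ≥ 3√ω/4.
  refine ⟨L, R₀ α ω L / 2, min (min (R₀ α ω L / 2) (τ / 2)) (min 1 (√ω / 4)),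
    (le_max_left _ _).trans (le_max_left _ _), by positivity, fun p u hu hclose => ?_⟩
  have hc : ∀ z, |R₀ α ω z - (u z).1| < min (min (R₀ α ω L / 2) (τ / 2)) (min 1 (√ω / 4)) ∧
      |S₀ α ω z - (u z).2.1| < min (min (R₀ α ω L / 2) (τ / 2)) (min 1 (√ω / 4)) ∧
      |(u z).2.2| < min (min (R₀ α ω L / 2) (τ / 2)) (min 1 (√ω / 4)) := by
    intro z
    have := hclose z
    simp only [Prod.dist_eq, wave₀, max_lt_iff, Real.dist_eq, zero_sub, abs_neg] at this
    exact this
  simp only [lt_min_iff, abs_lt] at hc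
  obtain ⟨s₁, φ₁, -, hbot⟩ := hu.emanates
  obtain ⟨s₂, φ₂, -, htop⟩ := hu.decays
  refine ⟨⟨by positivity, by positivity, by positivity, hτ, fun z => (hu.solves z trivial).1,
    fun z => ?_, fun z => ?_, fun z hz => ?_, fun z hz => ?_, fun z hz => ?_, fun z hz => ?_,
    fun z hz => ?_, fun z => (hu.solves z trivial).2.fst,
    (continuous_fst.tendsto _).comp hbot, (continuous_fst.tendsto _).comp htop⟩, fun z => ?_⟩
  · linarith [(hc z).1.2.1.1, R₀_le (α := α) hω z]
  · have := abs_le.mp (abs_S₀_le (α := α) hω z)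
    exact abs_le.mpr ⟨by linarith [(hc z).2.1.2.1.2], by linarith [(hc z).2.1.2.1.1]⟩
  · linarith [(hc z).1.1.1.2, R₀_ge (α := α) hω hz]
  · linarith [(hc z).2.1.2.2.2, (hleft z hz).1]
  · linarith [(hc z).2.1.2.2.1, (hright z hz).1]
  · linarith [(hc z).1.1.2.1, (hleft z hz).2]
  · linarith [(hc z).1.1.2.1, (hright z hz).2]
  · exact abs_le.mpr ⟨by linarith [(hc z).2.2.1.2.1], by linarith [(hc z).2.2.1.2.2]⟩

end UnperturbedWave

/-! ### Bounds along the wave that are uniform in ε -/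

theorem Coeffs.one_le_Δ (p : Coeffs) : 1 ≤ p.Δ := by
  have : 0 ≤ p.ε ^ 2 * p.a ^ 2 := by positivity
  unfold Coeffs.Δ
  linarith

theorem Coeffs.abs_div_Δ_le (p : Coeffs) (x : ℝ) : |x / p.Δ| ≤ |x| := by
  rw [abs_div, abs_of_pos p.Δ_pos]
  exact div_le_self (abs_nonneg x) p.one_le_Δ

/-- The phase equation at speed zero. -/
theorem Coeffs.field_phase (p : Coeffs) (ω : ℝ) (u : State) :
    (p.field ω 0 u).2.2 = -2 * u.2.1 * u.2.2 + p.ε / p.Δ *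
      (-((p.b + p.a * ω) + (p.d₂ - p.a * p.α) * u.1 ^ 4) - (p.d₁ - p.a) * u.1 ^ 2) := by
  have := p.Δ_pos.ne'
  simp only [Coeffs.field]
  field_simp
  ring

/-- Bound of the phase forcing without the `d₁` term. -/
def forcingBound (p : Coeffs) (ω B : ℝ) : ℝ := |p.b + p.a * ω| + |p.d₂ - p.a * p.α| * B ^ 4

theorem abs_forcing_le (p : Coeffs) (ω : ℝ) {B r : ℝ} (h0 : 0 ≤ r) (hr : r ≤ B) :
    |(p.b + p.a * ω) + (p.d₂ - p.a * p.α) * r ^ 4| ≤ forcingBound p ω B := by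
  refine (abs_add_le _ _).trans ?_
  rw [abs_mul, abs_of_nonneg (pow_nonneg h0 4), forcingBound]
  gcongr

/-- The coefficient `d₁` of a solitary wave is bounded in terms of its profile constants. -/
theorem abs_d₁_sub_le {p : Coeffs} {ω : ℝ} {u : ℝ → State} {L σ m B τ : ℝ} (hε : 0 < p.ε)
    (hu : p.IsSolitaryWave ω u)
    (h : Profile (fun z => (u z).1) (fun z => (u z).2.1) L σ m B τ)
    (hφ : ∀ z, |(u z).2.2| ≤ τ) :
    |p.d₁ - p.a| ≤ B ^ 2 * forcingBound p ω B * (2 * L + 1 / σ) / (2 * L * m ^ 4) := by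
  have hder : ∀ z, HasDerivAt (fun z => (u z).2.2) (p.field ω 0 (u z)).2.2 z :=
    fun z => (hu.solves z trivial).2.snd.snd
  have he : 0 < p.ε / p.Δ := div_pos hε p.Δ_pos
  have hk : ∀ z, |(p.b + p.a * ω) + (p.d₂ - p.a * p.α) * (u z).1 ^ 4| ≤ forcingBound p ω B :=
    fun z => abs_forcing_le p ω (h.pos z).le (h.le z)
  -- `Profile.coeff_le` needs a nonnegative coefficient; in the other case it is applied to -Φ.
  rcases le_total 0 (p.d₁ - p.a) with hd | hd
  · rw [abs_of_nonneg hd]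
    refine h.coeff_le (f := fun z => (u z).2.2)
      (k := fun z => -((p.b + p.a * ω) + (p.d₂ - p.a * p.α) * (u z).1 ^ 4)) he hd
      (fun z => ?_) (fun z => by simpa only [abs_neg] using hk z) hφ
    have := hder z
    rwa [p.field_phase] at this
  · rw [abs_of_nonpos hd]
    refine h.coeff_le (f := fun z => -(u z).2.2)
      (k := fun z => (p.b + p.a * ω) + (p.d₂ - p.a * p.α) * (u z).1 ^ 4) he (by linarith)
      (fun z => ?_) hk (fun z => by simpa only [abs_neg] using hφ z)
    have := (hder z).neg
    rw [p.field_phase] at this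
    convert! this using 1
    ring

/-- A solitary wave with uniform profile constants and a perturbation small enough for the
coefficients of the linearised system to be bounded independently of `ε`. -/
structure Controlled (p : Coeffs) (ω : ℝ) (u : ℝ → State) (L σ m B τ D : ℝ) : Prop where
  wave : p.IsSolitaryWave ω u
  profile : Profile (fun z => (u z).1) (fun z => (u z).2.1) L σ m B τ
  phase : ∀ z, |(u z).2.2| ≤ τ
  ε_pos : 0 < p.ε
  ε_le : p.ε ≤ 1
  d₁_le : |p.d₁ - p.a| ≤ D
  small_d₁ : p.ε ^ 2 * |p.a * p.d₁| ≤ 1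
  small_d₂ : p.ε ^ 2 * |p.a * p.d₂| ≤ 1
  small_cubic : p.ε * |p.d₁ - p.a| ≤ 1
  small_quintic : p.ε * |p.d₂ - p.a * p.α| ≤ 1

/-- Gain of the damped equation on `(-∞, L]`. -/
def gain (L σ m B : ℝ) : ℝ := B ^ 2 * (1 / (2 * σ) + 2 * L) / m ^ 2

/-- Bound of the amplitude coefficients of the linearised system. -/
def couplingBound (α B : ℝ) : ℝ := 4 + 4 * (|α| + 1) * B ^ 2

namespace Controlled

variable {p : Coeffs} {ω : ℝ} {u : ℝ → State} {L σ m B τ D : ℝ}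

theorem reflect (h : Controlled p ω u L σ m B τ D) :
    Controlled p ω (fun z => reflection (u (-z))) L σ m B τ D where
  wave := h.wave.reflect
  profile := h.profile.reflect
  phase z := by simpa [reflection_apply] using h.phase (-z)
  ε_pos := h.ε_pos
  ε_le := h.ε_le
  d₁_le := h.d₁_le
  small_d₁ := h.small_d₁
  small_d₂ := h.small_d₂
  small_cubic := h.small_cubic
  small_quintic := h.small_quintic

theorem D_nonneg (h : Controlled p ω u L σ m B τ D) : 0 ≤ D := (abs_nonneg _).trans h.d₁_le

theorem gain_nonneg (h : Controlled p ω u L σ m B τ D) : 0 ≤ gain L σ m B := by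
  have := h.profile.L_pos
  have := h.profile.σ_pos
  unfold gain
  positivity

theorem forcing_le (h : Controlled p ω u L σ m B τ D) (z : ℝ) :
    |p.ε / p.Δ * (-((p.b + p.a * ω) + (p.d₂ - p.a * p.α) * (u z).1 ^ 4)
      - (p.d₁ - p.a) * (u z).1 ^ 2)| ≤ p.ε * (forcingBound p ω B + D * B ^ 2) := by
  have hR := h.profile.pos z
  have hRB := h.profile.le z
  have hε := h.ε_pos
  have hD := h.d₁_le
  have h1 := abs_forcing_le p ω hR.le hRB
  have h2 : |(p.d₁ - p.a) * (u z).1 ^ 2| ≤ D * B ^ 2 := by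
    rw [abs_mul, abs_of_nonneg (sq_nonneg (u z).1)]
    have := h.D_nonneg
    gcongr
  rw [div_mul_eq_mul_div]
  refine (p.abs_div_Δ_le _).trans ?_
  rw [abs_mul, abs_of_pos hε]
  gcongr
  refine (abs_sub _ _).trans ?_
  rw [abs_neg]
  exact add_le_add h1 h2

/-- The phase component is `O(ε)`. -/
theorem phase_le (h : Controlled p ω u L σ m B τ D) :
    ∀ z ≤ L, |(u z).2.2| ≤ p.ε * ((forcingBound p ω B + D * B ^ 2) * gain L σ m B) := by
  have hε := h.ε_pos
  have hG := (abs_nonneg _).trans (h.forcing_le 0)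
  intro z hz
  have := h.profile.abs_le_of_damped (f := fun z => (u z).2.2) hG (fun z => by
    have : HasDerivAt (fun z => (u z).2.2) (p.field ω 0 (u z)).2.2 z :=
      (h.wave.solves z trivial).2.snd.snd
    rwa [p.field_phase] at this) (fun z _ => h.forcing_le z) (fun z _ => h.phase z) z hz
  rw [← gain] at this
  linarith

theorem abs_qs_le (h : Controlled p ω u L σ m B τ D) (z : ℝ) :
    |p.qs (u z).1| ≤ couplingBound p.α B * (u z).1 := by
  have hR := h.profile.pos z
  have hRB := h.profile.le z
  set r := (u z).1
  have h1 : |1 + p.ε ^ 2 * p.a * p.d₁| ≤ 2 := by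
    refine (abs_add_le _ _).trans ?_
    rw [mul_assoc, abs_mul, abs_of_nonneg (sq_nonneg p.ε), abs_one]
    linarith [h.small_d₁]
  have h2 : |p.α + p.ε ^ 2 * p.a * p.d₂| ≤ |p.α| + 1 := by
    refine (abs_add_le _ _).trans ?_
    rw [mul_assoc, abs_mul, abs_of_nonneg (sq_nonneg p.ε)]
    linarith [h.small_d₂]
  unfold Coeffs.qs
  refine (p.abs_div_Δ_le _).trans ?_
  rw [abs_neg]
  calc |2 * (1 + p.ε ^ 2 * p.a * p.d₁) * r + 4 * (p.α + p.ε ^ 2 * p.a * p.d₂) * r ^ 3|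
      ≤ 2 * |1 + p.ε ^ 2 * p.a * p.d₁| * r + 4 * |p.α + p.ε ^ 2 * p.a * p.d₂| * r ^ 3 := by
        refine (abs_add_le _ _).trans (le_of_eq ?_)
        simp only [abs_mul, abs_pow, abs_of_pos hR, Nat.abs_ofNat]
    _ ≤ 2 * 2 * r + 4 * (|p.α| + 1) * (B ^ 2 * r) := by
        have : r ^ 3 ≤ B ^ 2 * r := by
          rw [pow_succ]
          gcongr
        gcongr
    _ = _ := by unfold couplingBound; ring

theorem abs_qφ_le (h : Controlled p ω u L σ m B τ D) (z : ℝ) :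
    |p.qφ (u z).1| ≤ p.ε * (2 * |p.d₁ - p.a| + 4 * |p.d₂ - p.a * p.α| * B ^ 2) * (u z).1 := by
  have hR := h.profile.pos z
  have hRB := h.profile.le z
  have hε := h.ε_pos
  set r := (u z).1
  unfold Coeffs.qφ
  refine (p.abs_div_Δ_le _).trans ?_
  rw [abs_neg, abs_mul, abs_of_pos hε, mul_assoc p.ε]
  gcongr
  calc |2 * (p.d₁ - p.a) * r + 4 * (p.d₂ - p.a * p.α) * r ^ 3|
      ≤ 2 * |p.d₁ - p.a| * r + 4 * |p.d₂ - p.a * p.α| * r ^ 3 := by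
        refine (abs_add_le _ _).trans (le_of_eq ?_)
        simp only [abs_mul, abs_pow, abs_of_pos hR, Nat.abs_ofNat]
    _ ≤ 2 * |p.d₁ - p.a| * r + 4 * |p.d₂ - p.a * p.α| * (B ^ 2 * r) := by
        have : r ^ 3 ≤ B ^ 2 * r := by
          rw [pow_succ]
          gcongr
        gcongr
    _ = _ := by ring

/-- A cruder form without the factor ε, matching the bound of `Coeffs.qs`, since
`Profile.linear_bound` takes one constant for both couplings. -/
theorem abs_qφ_le' (h : Controlled p ω u L σ m B τ D) (z : ℝ) :
    |p.qφ (u z).1| ≤ couplingBound p.α B * (u z).1 := by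
  refine (h.abs_qφ_le z).trans ?_
  have hR := h.profile.pos z
  gcongr
  have h1 := h.small_cubic
  have h2 := mul_le_mul_of_nonneg_right h.small_quintic (sq_nonneg B)
  have h3 : 0 ≤ |p.α| * B ^ 2 := by positivity
  unfold couplingBound
  linarith

theorem field_fst_le (h : Controlled p ω u L σ m B τ D) (z : ℝ) :
    |(p.field ω 0 (u z)).1| ≤ B ^ 2 := by
  have hB := h.profile.B_pos
  have hR := h.profile.pos z
  have hRB := h.profile.le z
  have hS := h.profile.abs_le z
  calc |(u z).1 * (u z).2.1| = (u z).1 * |(u z).2.1| := by rw [abs_mul, abs_of_pos hR]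
    _ ≤ B * B := by gcongr
    _ = B ^ 2 := by ring

/-- The smallness conditions of `Controlled` keep ε and d₁ out of the bound. -/
theorem field_snd_le (h : Controlled p ω u L σ m B τ D) (z : ℝ) :
    |(p.field ω 0 (u z)).2.1| ≤
      B ^ 2 + τ ^ 2 + (|ω| + |p.a * p.b|) + 2 * B ^ 2 + (|p.α| + 1) * B ^ 4 := by
  have hR := h.profile.pos z
  have hRB := h.profile.le z
  have hS := h.profile.abs_le z
  have hφ := h.phase z
  have hε := h.ε_pos
  have hΔ := p.Δ_pos.ne'
  have hε2 : p.ε ^ 2 ≤ 1 := pow_le_one₀ hε.le h.ε_le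
  have h1 : |1 + p.ε ^ 2 * p.a * p.d₁| ≤ 2 := by
    refine (abs_add_le _ _).trans ?_
    rw [mul_assoc, abs_mul, abs_of_nonneg (sq_nonneg p.ε), abs_one]
    linarith [h.small_d₁]
  have h2 : |p.α + p.ε ^ 2 * p.a * p.d₂| ≤ |p.α| + 1 := by
    refine (abs_add_le _ _).trans ?_
    rw [mul_assoc, abs_mul, abs_of_nonneg (sq_nonneg p.ε)]
    linarith [h.small_d₂]
  have h3 : |(-ω + p.ε ^ 2 * p.a * p.b)| ≤ |ω| + |p.a * p.b| := by
    refine (abs_add_le _ _).trans ?_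
    rw [mul_assoc, abs_mul, abs_of_nonneg (sq_nonneg p.ε), abs_neg]
    gcongr
    exact mul_le_of_le_one_left (abs_nonneg _) hε2
  have heq : (p.field ω 0 (u z)).2.1 = -(u z).2.1 ^ 2 + (u z).2.2 ^ 2
      + (-(-ω + p.ε ^ 2 * p.a * p.b)) / p.Δ + (-((1 + p.ε ^ 2 * p.a * p.d₁) * (u z).1 ^ 2)) / p.Δ
      + (-((p.α + p.ε ^ 2 * p.a * p.d₂) * (u z).1 ^ 4)) / p.Δ := by
    simp only [Coeffs.field]
    field_simp
    ring
  rw [heq]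
  refine (abs_add_le _ _).trans (add_le_add ((abs_add_le _ _).trans (add_le_add
    ((abs_add_le _ _).trans (add_le_add ((abs_add_le _ _).trans (add_le_add ?_ ?_)) ?_)) ?_)) ?_)
  · rw [abs_neg, abs_pow]
    gcongr
  · rw [abs_pow]
    gcongr
  · refine (p.abs_div_Δ_le _).trans ?_
    rwa [abs_neg]
  · refine (p.abs_div_Δ_le _).trans ?_
    rw [abs_neg, abs_mul, abs_pow, abs_of_pos hR]
    gcongr
  · refine (p.abs_div_Δ_le _).trans ?_
    rw [abs_neg, abs_mul, abs_pow, abs_of_pos hR]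
    gcongr

theorem field_phase_le (h : Controlled p ω u L σ m B τ D) {z : ℝ} (hz : z ≤ L) :
    |(p.field ω 0 (u z)).2.2| ≤
      p.ε * ((forcingBound p ω B + D * B ^ 2) * (2 * B * gain L σ m B + 1)) := by
  have hS := h.profile.abs_le z
  have hB := h.profile.B_pos
  have hφ := h.phase_le z hz
  rw [p.field_phase]
  calc _ ≤ |-2 * (u z).2.1 * (u z).2.2| + _ := abs_add_le _ _
    _ ≤ 2 * B * (p.ε * ((forcingBound p ω B + D * B ^ 2) * gain L σ m B))
        + p.ε * (forcingBound p ω B + D * B ^ 2) := by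
      refine add_le_add ?_ (h.forcing_le z)
      simp only [abs_mul, abs_neg, Nat.abs_ofNat]
      gcongr
    _ = _ := by ring

end Controlled

/-! ### The normalised speed derivative -/

theorem Coeffs.linearized_sub_smul (p : Coeffs) (κ : ℝ) (u ξ η : State) :
    p.linearized 1 u ξ - κ • p.linearized 0 u η = p.linearized 1 u (ξ - κ • η) := by
  simp only [Coeffs.linearized]
  refine Prod.ext ?_ (Prod.ext ?_ ?_)
  all_goals
    simp
    ring

/-- Bound of the forcing in the linearised system. -/
def speedForcing (a B τ : ℝ) : ℝ := (1 + |a|) * (B + τ)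

/-- Bound of the normalised speed derivative on `(-∞, L]`. -/
def linearBound (a α L σ B τ : ℝ) : ℝ :=
  gronwallBound (max (τ / σ * (speedForcing a B τ / σ)) (speedForcing a B τ / σ))
    (2 * B + 2 * τ + couplingBound α B * B) (speedForcing a B τ) (2 * L)

/-- Bound, relative to `ε`, of the deviation of the phase derivative from `-1/2`. -/
def phaseBound (p : Coeffs) (ω L σ m B τ D : ℝ) : ℝ :=
  (B * p.a ^ 2 + |p.a| * τ
    + 2 * ((forcingBound p ω B + D * B ^ 2) * gain L σ m B) * linearBound p.a p.α L σ B τ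
    + (2 * D + 4 * |p.d₂ - p.a * p.α| * B ^ 2) * B * linearBound p.a p.α L σ B τ) * gain L σ m B

namespace Controlled

variable {p : Coeffs} {ω : ℝ} {u : ℝ → State} {L σ m B τ D : ℝ}

/-- After subtracting a multiple of `ξ₁`, the speed derivative along the unstable manifold is
bounded on `(-∞, L]`, and its phase component is `-1/2 + O(ε)`. -/
theorem exists_normalized (h : Controlled p ω u L σ m B τ D)
    (hsmall : 2 * τ + couplingBound p.α B * τ * (τ / σ) ≤ σ) {W : ℝ → ℝ → State}
    (hW : p.IsUnstableFamily ω u W) :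
    ∃ κ : ℝ, ∀ z ≤ L, ‖ξ₂ W z - κ • ξ₁ W z‖ ≤ linearBound p.a p.α L σ B τ ∧
      |(ξ₂ W z - κ • ξ₁ W z).2.2 + 1 / 2| ≤ p.ε * phaseBound p ω L σ m B τ D := by
  have hL := h.profile.L_pos
  have hσ := h.profile.σ_pos
  have hB := h.profile.B_pos
  have hτ := h.profile.τ_pos
  have hε := h.ε_pos
  have hε1 := h.ε_le
  have hD := h.D_nonneg
  obtain ⟨K, hK⟩ := hW.bounded
  -- This fixes the time shift: δr vanishes at -L after subtracting κ ξ₁. The denominator is R S > 0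
  -- there.
  set κ := (ξ₂ W (-L)).1 / (ξ₁ W (-L)).1 with hκ
  set η : ℝ → State := fun z => ξ₂ W z - κ • ξ₁ W z with hη
  have hηder : ∀ z, HasDerivAt η (p.linearized 1 (u z) (η z)) z := fun z => by
    have := (hW.hasDerivAt_ξ₂ z).sub ((hW.hasDerivAt_ξ₁ z).const_smul κ)
    rwa [p.linearized_sub_smul] at this
  have hx0 : (η (-L)).1 = 0 := by
    have hne : (ξ₁ W (-L)).1 ≠ 0 := by
      rw [hW.ξ₁_eq]
      exact (mul_pos (h.profile.pos _) (hσ.trans_le (h.profile.left _ le_rfl))).ne'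
    simp only [hη, hκ, Prod.fst_sub, Prod.smul_fst, smul_eq_mul]
    field_simp
    ring
  -- This bound depends on the family through `K` and κ; it is only used qualitatively.
  have hbdd : ∃ K', ∀ z ≤ -L, |(η z).2.1| ≤ K' ∧ |(η z).2.2| ≤ K' := by
    refine ⟨K + |κ| * (max (B ^ 2) (max (B ^ 2 + τ ^ 2 + (|ω| + |p.a * p.b|) + 2 * B ^ 2
      + (|p.α| + 1) * B ^ 4) (p.ε * ((forcingBound p ω B + D * B ^ 2)
        * (2 * B * gain L σ m B + 1))))), fun z hz => ?_⟩
    have h1 : ‖η z‖ ≤ K + |κ| * (max (B ^ 2) (max (B ^ 2 + τ ^ 2 + (|ω| + |p.a * p.b|)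
        + 2 * B ^ 2 + (|p.α| + 1) * B ^ 4) (p.ε * ((forcingBound p ω B + D * B ^ 2)
        * (2 * B * gain L σ m B + 1))))) := by
      refine (norm_sub_le _ _).trans (add_le_add (hK z (by linarith)) ?_)
      rw [norm_smul, Real.norm_eq_abs, hW.ξ₁_eq]
      have h2 : ‖p.field ω 0 (u z)‖ ≤ _ := max_le_max (h.field_fst_le z)
        (max_le_max (h.field_snd_le z) (h.field_phase_le (by linarith : z ≤ L)))
      gcongr
    exact ⟨((le_max_left _ _).trans (le_max_right _ _)).trans h1,
      ((le_max_right _ _).trans (le_max_right _ _)).trans h1⟩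
  obtain ⟨K', hK'⟩ := hbdd
  have hQ : 0 ≤ couplingBound p.α B := by unfold couplingBound; positivity
  have hx : ∀ z, HasDerivAt (fun z => (η z).1) (p.linearized 1 (u z) (η z)).1 z :=
    fun z => (hηder z).fst
  have hy : ∀ z, HasDerivAt (fun z => (η z).2.1) (p.linearized 1 (u z) (η z)).2.1 z :=
    fun z => (hηder z).snd.fst
  have hw : ∀ z, HasDerivAt (fun z => (η z).2.2) (p.linearized 1 (u z) (η z)).2.2 z :=
    fun z => (hηder z).snd.snd
  have hforce : ∀ x : ℝ, |x| ≤ |p.ε * p.a| * B + τ ∨ |x| ≤ B + |p.ε * p.a| * τ →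
      |1 * (-x / p.Δ)| ≤ speedForcing p.a B τ := by
    intro x hx
    have h1 : |p.ε * p.a| ≤ |p.a| := by
      rw [abs_mul, abs_of_pos hε]
      exact mul_le_of_le_one_left (abs_nonneg _) hε1
    have h2 : |p.ε * p.a| * B ≤ |p.a| * B := by gcongr
    have h3 : |p.ε * p.a| * τ ≤ |p.a| * τ := by gcongr
    have h4 : 0 ≤ |p.a| * B := by positivity
    have h5 : 0 ≤ |p.a| * τ := by positivity
    rw [one_mul]
    refine (p.abs_div_Δ_le _).trans ?_
    rw [abs_neg]
    unfold speedForcing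
    rcases hx with hx | hx <;> linarith
  have hlin := h.profile.linear_bound (x := fun z => (η z).1) (y := fun z => (η z).2.1)
    (w := fun z => (η z).2.2) (p := fun z => 2 * (u z).2.2) (q := fun z => p.qs (u z).1)
    (q' := fun z => p.qφ (u z).1)
    (g := fun z => 1 * (-(p.ε * p.a * (u z).2.1 - (u z).2.2) / p.Δ))
    (k := fun z => 1 * (-((u z).2.1 + p.ε * p.a * (u z).2.2) / p.Δ))
    (P := 2 * τ) (G := speedForcing p.a B τ) hQ hx hy hw
    (fun z _ => by
      rw [abs_mul, Nat.abs_ofNat]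
      have := h.phase z
      gcongr)
    (fun z _ => h.abs_qs_le z) (fun z _ => h.abs_qφ_le' z)
    (fun z _ => hforce _ (Or.inl ((abs_sub _ _).trans (by
      rw [abs_mul]
      have := h.phase z
      have := h.profile.abs_le z
      gcongr))))
    (fun z _ => hforce _ (Or.inr ((abs_add_le _ _).trans (by
      rw [abs_mul _ (u z).2.2]
      have := h.phase z
      have := h.profile.abs_le z
      gcongr))))
    hsmall hx0 hK'
  rw [← linearBound] at hlin
  set C := linearBound p.a p.α L σ B τ with hC
  have hC0 : 0 ≤ C := (norm_nonneg _).trans (hlin 0 hL.le)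
  have hF : 0 ≤ (forcingBound p ω B + D * B ^ 2) * gain L σ m B := by
    have := h.gain_nonneg
    unfold forcingBound
    positivity
  refine ⟨κ, fun z hz => ⟨hlin z hz, ?_⟩⟩
  set G := B * p.a ^ 2 + |p.a| * τ
    + 2 * ((forcingBound p ω B + D * B ^ 2) * gain L σ m B) * C
    + (2 * D + 4 * |p.d₂ - p.a * p.α| * B ^ 2) * B * C with hG
  -- The shift by 1/2 replaces the forcing -S/Δ by S (Δ - 1)/Δ = S ε²a²/Δ. The remaining terms
  -- contain εa, Φ or `Coeffs.qφ`, so all of g is O(ε).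
  have hfin := h.profile.abs_le_of_damped (f := fun z => (η z).2.2 + 1 / 2)
    (g := fun z => (u z).2.1 * (p.ε ^ 2 * p.a ^ 2) / p.Δ + -(p.ε * p.a * (u z).2.2) / p.Δ
      + -(2 * (u z).2.2) * (η z).2.1 + p.qφ (u z).1 * (η z).1) (G := p.ε * G) (K := K' + 1 / 2)
    (by positivity) ?_ ?_ ?_ z hz
  · rw [← gain] at hfin
    calc _ ≤ _ := hfin
      _ = _ := by rw [phaseBound]; ring
  · intro z
    have hΔ := p.Δ_pos.ne'
    convert! (hw z).add_const (1 / 2) using 1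
    simp only [Coeffs.linearized]
    rw [show p.ε ^ 2 * p.a ^ 2 = p.Δ - 1 by unfold Coeffs.Δ; ring]
    field_simp
    ring
  · intro z hz
    have hηz := hlin z hz
    have hηx : |(η z).1| ≤ C := (le_max_left _ _).trans hηz
    have hηy : |(η z).2.1| ≤ C := ((le_max_left _ _).trans (le_max_right _ _)).trans hηz
    have hS := h.profile.abs_le z
    have hRB := h.profile.le z
    have hR := h.profile.pos z
    have hφ := h.phase z
    have hφ' := h.phase_le z hz
    have hq := h.abs_qφ_le z
    have hd := h.d₁_le
    have e1 : |(u z).2.1 * (p.ε ^ 2 * p.a ^ 2) / p.Δ| ≤ p.ε * (B * p.a ^ 2) := by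
      refine (p.abs_div_Δ_le _).trans ?_
      rw [abs_mul, abs_of_nonneg (by positivity : 0 ≤ p.ε ^ 2 * p.a ^ 2)]
      have : p.ε ^ 2 ≤ p.ε := by rw [sq]; exact mul_le_of_le_one_left hε.le hε1
      calc _ ≤ B * (p.ε * p.a ^ 2) := by gcongr
        _ = _ := by ring
    have e2 : |-(p.ε * p.a * (u z).2.2) / p.Δ| ≤ p.ε * (|p.a| * τ) := by
      refine (p.abs_div_Δ_le _).trans ?_
      rw [abs_neg, abs_mul, abs_mul, abs_of_pos hε, mul_assoc]
      gcongr
    have e3 : |-(2 * (u z).2.2) * (η z).2.1|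
        ≤ p.ε * (2 * ((forcingBound p ω B + D * B ^ 2) * gain L σ m B) * C) := by
      rw [abs_mul, abs_neg, abs_mul, Nat.abs_ofNat]
      calc _ ≤ 2 * (p.ε * ((forcingBound p ω B + D * B ^ 2) * gain L σ m B)) * C := by gcongr
        _ = _ := by ring
    have e4 : |p.qφ (u z).1 * (η z).1|
        ≤ p.ε * ((2 * D + 4 * |p.d₂ - p.a * p.α| * B ^ 2) * B * C) := by
      rw [abs_mul]
      calc _ ≤ (p.ε * (2 * D + 4 * |p.d₂ - p.a * p.α| * B ^ 2) * B) * C := by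
            refine mul_le_mul (hq.trans ?_) hηx (abs_nonneg _) (by positivity)
            gcongr
        _ = _ := by ring
    refine (abs_add_le _ _).trans (le_trans (add_le_add ((abs_add_le _ _).trans
      (add_le_add ((abs_add_le _ _).trans (add_le_add e1 e2)) e3)) e4) (le_of_eq ?_))
    rw [hG]
    ring
  · intro z hz
    refine (abs_add_le _ _).trans ?_
    rw [abs_of_pos (by norm_num : (0 : ℝ) < 1 / 2)]
    gcongr
    exact (hK' z hz).2

end Controlled

/-! ### Phase derivative at ε = 0 and comparison of wedge products -/

/-- The phase component of the speed derivative along the unstable manifold of the unperturbed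
wave is constant. -/
theorem phase_deriv_unperturbed {α ω a b d₁ d₂ : ℝ} (hω : 0 < ω) (hβ : β α ω < 1)
    {W : ℝ → ℝ → State} (hwave : Coeffs.IsSolitaryWave ⟨0, a, b, d₁, d₂, α⟩ ω (wave₀ α ω))
    (hW : Coeffs.IsUnstableFamily ⟨0, a, b, d₁, d₂, α⟩ ω (wave₀ α ω) W) (z : ℝ) :
    (ξ₂ W z).2.2 = -1 / 2 := by
  -- The tail amplitude plays no role here, so 1 is taken; passing z ensures z ≤ L.
  obtain ⟨L, m, e, hzL, he, hprof⟩ := exists_profile hω hβ one_pos z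
  obtain ⟨hp, -⟩ := hprof _ _ hwave (fun z => by simpa using he)
  obtain ⟨K, hK⟩ := hW.bounded
  have hL := hp.L_pos
  have := hp.abs_le_of_damped (f := fun z => (ξ₂ W z).2.2 + 1 / 2) (g := fun _ => 0) (G := 0)
    (K := K + 1 / 2) le_rfl (fun z => ?_) (fun z _ => by simp) (fun z hz => ?_) z hzL
  · rw [zero_mul] at this
    linarith [abs_nonpos_iff.mp this]
  · have hw : HasDerivAt (fun z => (ξ₂ W z).2.2)
        (Coeffs.linearized ⟨0, a, b, d₁, d₂, α⟩ 1 (wave₀ α ω z) (ξ₂ W z)).2.2 z :=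
      (hW.hasDerivAt_ξ₂ z).snd.snd
    convert! hw.add_const (1 / 2) using 1
    simp only [Coeffs.linearized, Coeffs.qφ, Coeffs.Δ, wave₀]
    norm_num
    ring
  · refine (abs_add_le _ _).trans ?_
    rw [abs_of_pos (by norm_num : (0 : ℝ) < 1 / 2)]
    gcongr
    exact ((le_max_right _ _).trans (le_max_right _ _)).trans (hK z (by linarith))

/-- Makes the wedge products insensitive to the choice of parametrisation, and allows different κ on
the two sides. -/
theorem wedge_sub_smul (x y : State →ₗ[ℝ] ℝ) (κ : ℝ) (ξ η : State) :
    wedge x y ξ (η - κ • ξ) = wedge x y ξ η := by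
  simp only [wedge, map_sub, map_smul, smul_eq_mul]
  ring

/-- Two vectors that are bounded by `C₁` and agree in the phase component up to `2 ε C₂` have
nearly the same wedge product with a vector whose phase component is `O(ε)`. -/
theorem abs_wedge_sub_le {x : State →ₗ[ℝ] ℝ} {ξ η₁ η₂ : State} {ε A A' C₁ C₂ : ℝ}
    (hx : |x ξ| ≤ A) (hφ : |ξ.2.2| ≤ ε * A') (h₁ : |x η₁| ≤ C₁) (h₂ : |x η₂| ≤ C₁)
    (hφ₁ : |η₁.2.2 + 1 / 2| ≤ ε * C₂) (hφ₂ : |η₂.2.2 + 1 / 2| ≤ ε * C₂) :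
    |wedge x δφ ξ η₁ - wedge x δφ ξ η₂| ≤ (2 * A * C₂ + 2 * A' * C₁) * ε := by
  have heq : wedge x δφ ξ η₁ - wedge x δφ ξ η₂
      = x ξ * ((η₁.2.2 + 1 / 2) - (η₂.2.2 + 1 / 2)) - ξ.2.2 * (x η₁ - x η₂) := by
    have : ∀ v : State, δφ v = v.2.2 := fun _ => rfl
    simp only [wedge, this]
    ring
  rw [heq]
  have hA : 0 ≤ A := (abs_nonneg _).trans hx
  have hA' : 0 ≤ ε * A' := (abs_nonneg _).trans hφ
  calc _ ≤ |x ξ| * |(η₁.2.2 + 1 / 2) - (η₂.2.2 + 1 / 2)| + |ξ.2.2| * |x η₁ - x η₂| := by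
        rw [← abs_mul, ← abs_mul]
        exact abs_sub _ _
    _ ≤ A * (ε * C₂ + ε * C₂) + ε * A' * (C₁ + C₁) := by
        have e1 := (abs_sub (η₁.2.2 + 1 / 2) (η₂.2.2 + 1 / 2)).trans (add_le_add hφ₁ hφ₂)
        have e2 := (abs_sub (x η₁) (x η₂)).trans (add_le_add h₁ h₂)
        gcongr
    _ = _ := by ring

/-- The bounds of `Controlled.exists_normalized` along the stable manifold. -/
theorem Controlled.exists_normalized_stable {p : Coeffs} {ω : ℝ} {u : ℝ → State}
    {L σ m B τ D : ℝ} (h : Controlled p ω u L σ m B τ D)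
    (hsmall : 2 * τ + couplingBound p.α B * τ * (τ / σ) ≤ σ) {W : ℝ → ℝ → State}
    (hW : p.IsStableFamily ω u W) :
    ∃ κ : ℝ, ∀ z, -L ≤ z →
      ‖ξ₂ W z - κ • p.field ω 0 (u z)‖ ≤ linearBound p.a p.α L σ B τ ∧
      |(ξ₂ W z - κ • p.field ω 0 (u z)).2.2 + 1 / 2| ≤ p.ε * phaseBound p ω L σ m B τ D := by
  obtain ⟨κ, hκ⟩ := h.reflect.exists_normalized hsmall hW.reflect
  refine ⟨κ, fun z hz => ?_⟩
  have hz' := hκ (-z) (by linarith)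
  have hf := p.field_reflection ω 0 (u z)
  rw [neg_zero] at hf
  rw [hW.ξ₂_reflect, hW.reflect.ξ₁_eq, neg_neg, hf] at hz'
  have heq : -reflection (ξ₂ W z) - κ • -reflection (p.field ω 0 (u z))
      = -reflection (ξ₂ W z - κ • p.field ω 0 (u z)) := by
    rw [map_sub, map_smul]
    module
  rw [heq] at hz'
  set η := ξ₂ W z - κ • p.field ω 0 (u z)
  have hnorm : ‖-reflection η‖ = ‖η‖ := by
    rw [norm_neg, reflection_apply]
    simp [Prod.norm_def]
  have hthird : (-reflection η).2.2 = η.2.2 := by simp [reflection_apply]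
  rwa [hnorm, hthird] at hz'

/-- The difference of the wedge products along the stable and the unstable manifold is `O(ε)`. -/
theorem Controlled.abs_wedge_sub_le {p : Coeffs} {ω : ℝ} {u : ℝ → State} {L σ m B τ D : ℝ}
    (h : Controlled p ω u L σ m B τ D)
    (hsmall : 2 * τ + couplingBound p.α B * τ * (τ / σ) ≤ σ) {Wu Ws : ℝ → ℝ → State}
    (hu : p.IsUnstableFamily ω u Wu) (hs : p.IsStableFamily ω u Ws) {z : ℝ} (hz : |z| ≤ L) :
    |wedge δr δφ (ξ₁ Wu z) (ξ₂ Ws z) - wedge δr δφ (ξ₁ Wu z) (ξ₂ Wu z)| ≤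
      (2 * B ^ 2 * phaseBound p ω L σ m B τ D
        + 2 * ((forcingBound p ω B + D * B ^ 2) * (2 * B * gain L σ m B + 1))
          * linearBound p.a p.α L σ B τ) * p.ε ∧
    |wedge δs δφ (ξ₁ Wu z) (ξ₂ Ws z) - wedge δs δφ (ξ₁ Wu z) (ξ₂ Wu z)| ≤
      (2 * (B ^ 2 + τ ^ 2 + (|ω| + |p.a * p.b|) + 2 * B ^ 2 + (|p.α| + 1) * B ^ 4)
          * phaseBound p ω L σ m B τ D
        + 2 * ((forcingBound p ω B + D * B ^ 2) * (2 * B * gain L σ m B + 1))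
          * linearBound p.a p.α L σ B τ) * p.ε := by
  obtain ⟨hz1, hz2⟩ := abs_le.mp hz
  obtain ⟨κu, hκu⟩ := h.exists_normalized hsmall hu
  obtain ⟨κs, hκs⟩ := h.exists_normalized_stable hsmall hs
  obtain ⟨hnu, hφu⟩ := hκu z hz2
  obtain ⟨hns, hφs⟩ := hκs z hz1
  rw [hu.ξ₁_eq] at hnu hφu
  have hφ := h.field_phase_le hz2
  rw [hu.ξ₁_eq]
  constructor
  · rw [← wedge_sub_smul δr δφ κu _ (ξ₂ Wu z), ← wedge_sub_smul δr δφ κs _ (ξ₂ Ws z)]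
    exact CubicQuintic.abs_wedge_sub_le (h.field_fst_le z) hφ ((le_max_left _ _).trans hns)
      ((le_max_left _ _).trans hnu) hφs hφu
  · rw [← wedge_sub_smul δs δφ κu _ (ξ₂ Wu z), ← wedge_sub_smul δs δφ κs _ (ξ₂ Ws z)]
    exact CubicQuintic.abs_wedge_sub_le (h.field_snd_le z) hφ
      (((le_max_left _ _).trans (le_max_right _ _)).trans hns)
      (((le_max_left _ _).trans (le_max_right _ _)).trans hnu) hφs hφu

/-! ### Common constants for small ε, and the theorem -/

/-- For small `ε` the waves of a family converging uniformly to the unperturbed wave are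
controlled with common constants. -/
theorem eventually_controlled {α ω a b d₂ : ℝ} (hω : 0 < ω) (hβ : β α ω < 1) {τ : ℝ} (hτ : 0 < τ)
    (M : ℝ) {d₁ : ℝ → ℝ} {wave : ℝ → ℝ → State}
    (hwave : ∀ᶠ ε in 𝓝[>] (0 : ℝ), Coeffs.IsSolitaryWave ⟨ε, a, b, d₁ ε, d₂, α⟩ ω (wave ε))
    (hconv : TendstoUniformly wave (wave₀ α ω) (𝓝[>] (0 : ℝ))) :
    ∃ L m D : ℝ, M ≤ L ∧ ∀ᶠ ε in 𝓝[>] (0 : ℝ), Controlled ⟨ε, a, b, d₁ ε, d₂, α⟩ ω (wave ε)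
      L (√ω / 2) m (2 * √ω + 1) τ D := by
  obtain ⟨L, m, e, hML, he, hprof⟩ := exists_profile hω hβ hτ M
  -- `forcingBound` ignores ε and d₁, so zeros may stand for them. The absolute value gives D ≥ 0
  -- before any profile, and hence any sign of L or m, is available.
  set D := |(2 * √ω + 1) ^ 2 * forcingBound ⟨0, a, b, 0, d₂, α⟩ ω (2 * √ω + 1)
    * (2 * L + 1 / (√ω / 2)) / (2 * L * m ^ 4)| with hD
  have hD0 : 0 ≤ D := abs_nonneg _
  -- The sum of all quantities that ε has to make small; ε ≤ 1/E meets every condition at once.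
  set E := 1 + |a| * (D + |a|) + |a * d₂| + D + |d₂ - a * α| with hE
  have h1 : 0 ≤ |a| * (D + |a|) := by positivity
  have h2 : 0 ≤ |a * d₂| := abs_nonneg _
  have h3 : 0 ≤ |d₂ - a * α| := abs_nonneg _
  have hEpos : 0 < E := by linarith
  refine ⟨L, m, D, hML, ?_⟩
  filter_upwards [hwave, Metric.tendstoUniformly_iff.mp hconv e he, self_mem_nhdsWithin,
    nhdsWithin_le_nhds (eventually_le_nhds (by positivity : (0 : ℝ) < 1 / E))]
    with ε hsol hclose hε hεE
  have hε : 0 < ε := hε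
  obtain ⟨hp, hφ⟩ := hprof _ _ hsol hclose
  have hd : |d₁ ε - a| ≤ D := (abs_d₁_sub_le hε hsol hp hφ).trans (le_abs_self _)
  have hmul : ∀ t, t ≤ E → ε * t ≤ 1 := fun t ht => by
    calc ε * t ≤ ε * E := by gcongr
      _ ≤ 1 / E * E := by gcongr
      _ = 1 := by field_simp
  have hε1 : ε ≤ 1 := by simpa using hmul 1 (by linarith)
  have hsq : ∀ t, 0 ≤ t → t ≤ E → ε ^ 2 * t ≤ 1 := fun t ht0 ht => by
    have := hmul t ht
    calc ε ^ 2 * t = ε * (ε * t) := by ring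
      _ ≤ 1 * 1 := by gcongr
      _ = 1 := one_mul 1
  refine ⟨hsol, hp, hφ, hε, hε1, hd, hsq _ (abs_nonneg _) ?_, hsq _ (abs_nonneg _) ?_,
    hmul _ ?_, hmul _ ?_⟩
  · have h4 : |d₁ ε| ≤ D + |a| := by
      calc |d₁ ε| = |(d₁ ε - a) + a| := by ring_nf
        _ ≤ _ := (abs_add_le _ _).trans (by gcongr)
    have h5 : |a * d₁ ε| ≤ |a| * (D + |a|) := by rw [abs_mul]; gcongr
    exact h5.trans (by linarith)
  · change |a * d₂| ≤ E
    linarith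
  · exact hd.trans (by linarith)
  · change |d₂ - a * α| ≤ E
    linarith

end CubicQuintic

end

theorem mainTheorem10 (α ω a b d₂ : ℝ) (hω : 0 < ω) (hβ : CubicQuintic.β α ω < 1) :
    -- the unperturbed case `ε = 0`
    (∀ (d₁ : ℝ) (Wu Ws : ℝ → ℝ → CubicQuintic.State),
      CubicQuintic.Coeffs.IsUnstableFamily ⟨0, a, b, d₁, d₂, α⟩ ω
        (CubicQuintic.wave₀ α ω) Wu →
      CubicQuintic.Coeffs.IsStableFamily ⟨0, a, b, d₁, d₂, α⟩ ω
        (CubicQuintic.wave₀ α ω) Ws →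
      ∀ z : ℝ,
        (CubicQuintic.δφ (CubicQuintic.ξ₂ Wu z) = -1 / 2 ∧
          CubicQuintic.δφ (CubicQuintic.ξ₂ Ws z) = -1 / 2) ∧
        (CubicQuintic.wedge CubicQuintic.δr CubicQuintic.δφ
            (CubicQuintic.ξ₁ Wu z) (CubicQuintic.ξ₂ Wu z)
              = -(1 / 2) * deriv (CubicQuintic.R₀ α ω) z ∧
          CubicQuintic.wedge CubicQuintic.δr CubicQuintic.δφ
            (CubicQuintic.ξ₁ Wu z) (CubicQuintic.ξ₂ Ws z)
              = -(1 / 2) * deriv (CubicQuintic.R₀ α ω) z) ∧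
        (CubicQuintic.wedge CubicQuintic.δs CubicQuintic.δφ
            (CubicQuintic.ξ₁ Wu z) (CubicQuintic.ξ₂ Wu z)
              = -(1 / 2) * deriv (CubicQuintic.S₀ α ω) z ∧
          CubicQuintic.wedge CubicQuintic.δs CubicQuintic.δφ
            (CubicQuintic.ξ₁ Wu z) (CubicQuintic.ξ₂ Ws z)
              = -(1 / 2) * deriv (CubicQuintic.S₀ α ω) z)) ∧
    -- the perturbed case: a family of solitary waves that perturbs regularly from `ε = 0`
    (∀ (d₁ : ℝ → ℝ) (wave : ℝ → ℝ → CubicQuintic.State),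
      (∀ᶠ ε in 𝓝[>] (0 : ℝ),
        CubicQuintic.Coeffs.IsSolitaryWave ⟨ε, a, b, d₁ ε, d₂, α⟩ ω (wave ε)) →
      TendstoUniformly wave (CubicQuintic.wave₀ α ω) (𝓝[>] (0 : ℝ)) →
      ∀ M > 0, ∃ C > 0, ∃ ε₀ > 0, ∀ ε ∈ Ioo (0 : ℝ) ε₀,
        ∀ Wu Ws : ℝ → ℝ → CubicQuintic.State,
          CubicQuintic.Coeffs.IsUnstableFamily ⟨ε, a, b, d₁ ε, d₂, α⟩ ω (wave ε) Wu →
          CubicQuintic.Coeffs.IsStableFamily ⟨ε, a, b, d₁ ε, d₂, α⟩ ω (wave ε) Ws →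
          ∀ z : ℝ, |z| ≤ M →
            |CubicQuintic.wedge CubicQuintic.δr CubicQuintic.δφ
                (CubicQuintic.ξ₁ Wu z) (CubicQuintic.ξ₂ Ws z)
              - CubicQuintic.wedge CubicQuintic.δr CubicQuintic.δφ
                (CubicQuintic.ξ₁ Wu z) (CubicQuintic.ξ₂ Wu z)| ≤ C * ε ∧
            |CubicQuintic.wedge CubicQuintic.δs CubicQuintic.δφ
                (CubicQuintic.ξ₁ Wu z) (CubicQuintic.ξ₂ Ws z)
              - CubicQuintic.wedge CubicQuintic.δs CubicQuintic.δφ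
                (CubicQuintic.ξ₁ Wu z) (CubicQuintic.ξ₂ Wu z)| ≤ C * ε) := by
  open CubicQuintic in
  refine ⟨fun d₁ Wu Ws hu hs z => ?_, fun d₁ wave hwave hconv M _ => ?_⟩
  -- The equation and the limits of the explicit wave are read off from the given families at speed
  -- 0 and need no computation.
  · have hsol : Coeffs.IsSolitaryWave ⟨0, a, b, d₁, d₂, α⟩ ω (wave₀ α ω) := by
      refine ⟨fun z _ => hu.solves z, ?_, ?_⟩
      · obtain ⟨δ, hδ, -, h⟩ := hu.regular 0
        simpa only [hu.base] using (h 0 ⟨by linarith, hδ⟩).2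
      · obtain ⟨δ, hδ, -, h⟩ := hs.regular 0
        simpa only [hs.base] using (h 0 ⟨by linarith, hδ⟩).2
    have hφu : δφ (ξ₂ Wu z) = -1 / 2 := phase_deriv_unperturbed hω hβ hsol hu z
    have hφs : δφ (ξ₂ Ws z) = -1 / 2 := by
      have hrefl : (fun z => reflection (wave₀ α ω (-z))) = wave₀ α ω := by
        funext z
        simp [wave₀_neg hω, reflection_apply]
      have hs' := hs.reflect
      rw [hrefl] at hs'
      have := phase_deriv_unperturbed hω hβ hsol hs' (-z)
      rw [hs.ξ₂_reflect, neg_neg] at this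
      rw [reflection_apply, Prod.snd_neg, Prod.snd_neg, neg_neg] at this
      exact this
    have hder : HasDerivAt (wave₀ α ω) (ξ₁ Wu z) z := by
      rw [hu.ξ₁_eq]
      exact (hu.solves z).2
    have hr : HasDerivAt (R₀ α ω) (δr (ξ₁ Wu z)) z := hder.fst
    have hS : HasDerivAt (S₀ α ω) (δs (ξ₁ Wu z)) z := hder.snd.fst
    have hφ : HasDerivAt (fun _ : ℝ => (0 : ℝ)) (δφ (ξ₁ Wu z)) z := hder.snd.snd
    have hφ0 : δφ (ξ₁ Wu z) = 0 := hφ.unique (hasDerivAt_const z 0)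
    rw [hr.deriv, hS.deriv]
    refine ⟨⟨hφu, hφs⟩, ⟨?_, ?_⟩, ?_, ?_⟩ <;> simp only [wedge, hφu, hφs, hφ0] <;> ring
  · have hs : 0 < √ω := Real.sqrt_pos.mpr hω
    have hQ : 0 < couplingBound α (2 * √ω + 1) := by unfold couplingBound; positivity
    obtain ⟨τ, hτ, hsmall⟩ : ∃ τ > 0,
        2 * τ + couplingBound α (2 * √ω + 1) * τ * (τ / (√ω / 2)) ≤ √ω / 2 := by
      -- With σ = √ω/2 and Q the coupling bound: τ ≤ σ/4 gives 2τ ≤ σ/2 and τ/σ ≤ 1, and the second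
      -- entry gives Qτ ≤ σ/2.
      refine ⟨min (√ω / 2 / 4) (√ω / 2 / (2 * couplingBound α (2 * √ω + 1))), by positivity, ?_⟩
      set τ := min (√ω / 2 / 4) (√ω / 2 / (2 * couplingBound α (2 * √ω + 1)))
      have hτ : 0 < τ := by positivity
      have h1 : τ ≤ √ω / 2 / 4 := min_le_left _ _
      have h2 : couplingBound α (2 * √ω + 1) * τ ≤ √ω / 2 / 2 := by
        have : τ ≤ √ω / 2 / (2 * couplingBound α (2 * √ω + 1)) := min_le_right _ _
        rw [le_div_iff₀ (by positivity)] at this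
        linarith
      have h3 : τ / (√ω / 2) ≤ 1 := by
        rw [div_le_one (by positivity)]
        linarith
      have h4 : couplingBound α (2 * √ω + 1) * τ * (τ / (√ω / 2)) ≤ √ω / 2 / 2 * 1 := by gcongr
      linarith
    obtain ⟨L, m, D, hML, hev⟩ := eventually_controlled hω hβ hτ M hwave hconv
    obtain ⟨ε₀, hε₀, hsub⟩ := (mem_nhdsGT_iff_exists_Ioo_subset).mp hev
    set σ := √ω / 2
    set B := 2 * √ω + 1
    -- The constants do not involve ε or d₁, so those computed from `p₀` agree definitionally with
    -- those at every ε.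
    set p₀ : Coeffs := ⟨0, a, b, 0, d₂, α⟩
    set C₁ := 2 * B ^ 2 * phaseBound p₀ ω L σ m B τ D
        + 2 * ((forcingBound p₀ ω B + D * B ^ 2) * (2 * B * gain L σ m B + 1))
          * linearBound a α L σ B τ
    set C₂ := 2 * (B ^ 2 + τ ^ 2 + (|ω| + |a * b|) + 2 * B ^ 2 + (|α| + 1) * B ^ 4)
          * phaseBound p₀ ω L σ m B τ D
        + 2 * ((forcingBound p₀ ω B + D * B ^ 2) * (2 * B * gain L σ m B + 1))
          * linearBound a α L σ B τ
    refine ⟨max (max C₁ C₂) 1, by positivity, ε₀, hε₀, fun ε hε Wu Ws hu hs z hz => ?_⟩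
    have hC : Controlled ⟨ε, a, b, d₁ ε, d₂, α⟩ ω (wave ε) L σ m B τ D := hsub hε
    obtain ⟨h1, h2⟩ := hC.abs_wedge_sub_le hsmall hu hs (hz.trans hML)
    have hε0 := hε.1
    have hC1 : C₁ ≤ max (max C₁ C₂) 1 := (le_max_left _ _).trans (le_max_left _ _)
    have hC2 : C₂ ≤ max (max C₁ C₂) 1 := (le_max_right _ _).trans (le_max_left _ _)
    exact ⟨h1.trans (mul_le_mul_of_nonneg_right hC1 hε0.le),
      h2.trans (mul_le_mul_of_nonneg_right hC2 hε0.le)⟩
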